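/- All alphabets $\mathcal X,\mathcal Y,\mathcal Z$ are finite and all logarithms are in base two. Let $p_{YZ|X}$ be a wiretap channel ($X$ is the input, $Y$ the output at the legitimate receiver, $Z$ the output at the eavesdropper), used memorylessly, let $p(x)$ be an input distribution, $p(x,y,z)=p(x)p(y,z|x)$, and $q(z^n)=\prod_{i=1}^n p(z_i)$. For $\alpha\in(1,\infty)$ put $$\tilde H_\alpha(X|Z)=\frac1{1-\alpha}\log\sum_z p(z)\sum_x p(x|z)^\alpha,\qquad \tilde H_\infty(X|Z)=\log\frac1{\max_{x,z}p(x|z)},$$ $$D_\alpha(P\|Q)=\frac1{\alpha-1}\log\sum_a P(a)^\alpha Q(a)^{1-\alpha},\quad D_\infty(P\|Q)=\log\max_a\frac{P(a)}{Q(a)},\quad T_\alpha(P\|Q)=\frac1{\alpha-1}\Big(\sum_a P(a)^\alpha Q(a)^{1-\alpha}-1\Big)$$ (the maxima are over points where the ratio is defined, and the divergences are $+\infty$ if $P\not\ll Q$). For a code with message $M$ uniform on its message set, the leakage of order $\alpha$ is $T_\alpha\big(p(m,z^n)\,\|\,p^U(m)q(z^n)\big)$ if $\alpha\in(1,\infty)$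 and $D_\infty\big(p(m,z^n)\,\|\,p^U(m)q(z^n)\big)$ if $\alpha=\infty$, where $p^U$ is the uniform distribution. Corollary. Let $\alpha\in(1,\infty]$. (1) Let $R\ge 0$ with $$R<\tilde H_\alpha(X|Z)-H(X|Y).$$ Then $R$ is a secure rate achieved by random binning of i.i.d. sequences: there are $R_1,R_2>0$ such that, if each $x^n\in\mathcal X^n$ is assigned independently and uniformly a pair of bin indices $\mathcal B(x^n)=(m,f)\in[\lfloor 2^{nR_1}\rfloor]\times[\lfloor 2^{nR_2}\rfloor]$, and $F$ is the second bin index of a sequence $X^n\sim\prod_i p(x_i)$ independent of $\mathcal B$, then for every $\delta>0$, with probability tending to one as $n\to\infty$, the pair $(\mathcal B,F)=(\beta,f)$ has the following property: there is a set of at least $2^{nR}$ indices $m$, comprising at least half of all of them, such that the code which uses these indices as equiprobable messages and sends $m$ as a random word with the law $P(x^n|m,f)$ of the i.i.d. sequence $X^n$ given its two bin indices has, for a suitable decoder, error probability at most $\delta$ and leakage of order $\alpha$ at most $\delta$. In particular, there is a sequence of codes of block lengths $n$ which for all large $n$ have at least $2^{nR}$ messages and whose error probability and leakage of order $\alpha$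 tend to $0$. (2) These rates are no larger than those obtained from typical sequences: $$\tilde H_\alpha(X|Z)\le H(X)-\sum_x p(x)D_\alpha\big(p(z|x)\,\|\,p(z)\big),$$ and hence $$\tilde H_\alpha(X|Z)-H(X|Y)\le I(X;Y)-\sum_x p(x)D_\alpha\big(p(z|x)\,\|\,p(z)\big),$$ where $0\cdot\infty=0$. -/

import Mathlib

open Filter Topology
open scoped ENNReal

noncomputable section

namespace Wiretap

/-! ### Information measures on finite alphabets

Probability mass functions on a finite type `κ` are elements of `stdSimplex ℝ κ`; a joint mass
function of a pair is written in curried form `P : 𝒜 → ℬ → ℝ`. All logarithms are in base two. -/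

section Measures

variable {κ 𝒜 ℬ : Type*} [Fintype κ] [Fintype 𝒜] [Fintype ℬ]

/-- `P` is not absolutely continuous with respect to `Q`. -/
def NotAC (P Q : κ → ℝ) : Prop := ∃ a, P a ≠ 0 ∧ Q a = 0

open Classical in
/-- Rényi divergence `D_α(P ‖ Q)` of order `α ∈ (1, ∞]`, with values in the extended reals.
For `α = ∞` it is `log max_a P(a)/Q(a)`, for finite `α` it is
`(α - 1)⁻¹ log ∑_a P(a)^α Q(a)^(1-α)`; it is `∞` if `P` is not absolutely continuous with respect
to `Q`. Points with `P(a) = Q(a) = 0` contribute nothing. -/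
def renyiDiv (α : ℝ≥0∞) (P Q : κ → ℝ) : EReal :=
  if NotAC P Q then ⊤
  else if α = ⊤ then ((Real.logb 2 (⨆ a, P a / Q a) : ℝ) : EReal)
  else ((1 / (α.toReal - 1) *
    Real.logb 2 (∑ a, P a ^ α.toReal * Q a ^ (1 - α.toReal)) : ℝ) : EReal)

open Classical in
/-- Tsallis divergence `T_α(P ‖ Q)` of finite order `α > 1`, with values in the extended reals. -/
def tsallisDiv (α : ℝ) (P Q : κ → ℝ) : EReal :=
  if NotAC P Q then ⊤
  else ((1 / (α - 1) * (∑ a, P a ^ α * Q a ^ (1 - α) - 1) : ℝ) : EReal)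

/-- The measure of secrecy of order `α`: Tsallis divergence `T_α` for `α ∈ (1, ∞)`, and
Rényi divergence `D_∞` for `α = ∞`. -/
def secrecyDiv (α : ℝ≥0∞) (P Q : κ → ℝ) : EReal :=
  if α = ⊤ then renyiDiv ⊤ P Q else tsallisDiv α.toReal P Q

/-- Shannon entropy `H(A)`. -/
def entropy (p : 𝒜 → ℝ) : ℝ := -∑ a, p a * Real.logb 2 (p a)

/-- The law of the first component. -/
def fstLaw (P : 𝒜 → ℬ → ℝ) (a : 𝒜) : ℝ := ∑ b, P a b

/-- The law of the second component. -/
def sndLaw (P : 𝒜 → ℬ → ℝ) (b : ℬ) : ℝ := ∑ a, P a b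

/-- Conditional probability `P(a | b)` (equal to `0` if `b` has probability `0`). -/
def condProb (P : 𝒜 → ℬ → ℝ) (a : 𝒜) (b : ℬ) : ℝ := P a b / sndLaw P b

/-- Conditional Shannon entropy `H(A | B)`. -/
def condEntropy (P : 𝒜 → ℬ → ℝ) : ℝ :=
  -∑ a, ∑ b, P a b * Real.logb 2 (condProb P a b)

/-- Mutual information `I(A; B)`. -/
def mutualInfo (P : 𝒜 → ℬ → ℝ) : ℝ :=
  ∑ a, ∑ b, P a b * Real.logb 2 (P a b / (fstLaw P a * sndLaw P b))

/-- Conditional Rényi entropy `H̃_α(A | B)` of order `α ∈ (1, ∞]`: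
`(1 - α)⁻¹ log ∑_b P(b) ∑_a P(a|b)^α` for finite `α`, and `log (1 / max_{a,b} P(a|b))`
for `α = ∞`. -/
def condRenyiEntropy (α : ℝ≥0∞) (P : 𝒜 → ℬ → ℝ) : ℝ :=
  if α = ⊤ then Real.logb 2 (1 / ⨆ ab : 𝒜 × ℬ, condProb P ab.1 ab.2)
  else 1 / (1 - α.toReal) *
    Real.logb 2 (∑ b, sndLaw P b * ∑ a, condProb P a b ^ α.toReal)

end Measures

/-! ### Channels and codes -/

section Codes

variable {𝒳 𝒴 𝒵 ℬ : Type*} [Fintype 𝒳] [Fintype 𝒴] [Fintype 𝒵] [Fintype ℬ]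

/-- The channel `p(y|x)` to the legitimate receiver. -/
def mainChannel (W : 𝒳 → 𝒴 × 𝒵 → ℝ) (x : 𝒳) (y : 𝒴) : ℝ := ∑ z, W x (y, z)

/-- The channel `p(z|x)` to the eavesdropper. -/
def tapChannel (W : 𝒳 → 𝒴 × 𝒵 → ℝ) (x : 𝒳) (z : 𝒵) : ℝ := ∑ y, W x (y, z)

/-- The joint law `p(x) V(b|x)` of the input and the output of a channel `V`. -/
def joint (p : 𝒳 → ℝ) (V : 𝒳 → ℬ → ℝ) (x : 𝒳) (b : ℬ) : ℝ := p x * V x b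

/-- The law `∏ᵢ p(xᵢ)` of an i.i.d. sequence. -/
def iidLaw {𝒜 : Type*} (p : 𝒜 → ℝ) {n : ℕ} (x : Fin n → 𝒜) : ℝ := ∏ i, p (x i)

/-- The `n`-fold memoryless channel `∏ᵢ V(bᵢ|xᵢ)`. -/
def memoryless {n : ℕ} (V : 𝒳 → ℬ → ℝ) (x : Fin n → 𝒳) (b : Fin n → ℬ) : ℝ :=
  ∏ i, V (x i) (b i)

/-- A block code of length `n` with `K` messages: the message `m` is sent as a random word with
law `enc m`, and the receiver decodes with the map `dec`. -/
structure WiretapCode (𝒳 𝒴 : Type*) [Fintype 𝒳] (n : ℕ) where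
  K : ℕ
  enc : Fin K → (Fin n → 𝒳) → ℝ
  enc_mem : ∀ m, enc m ∈ stdSimplex ℝ (Fin n → 𝒳)
  dec : (Fin n → 𝒴) → Fin K

namespace WiretapCode

variable {n : ℕ}

/-- The error probability of the receiver for a uniformly distributed message. -/
def errorProb (c : WiretapCode 𝒳 𝒴 n) (W : 𝒳 → 𝒴 × 𝒵 → ℝ) : ℝ :=
  (1 / (c.K : ℝ)) * ∑ m, ∑ x, c.enc m x *
    ∑ y, if c.dec y = m then 0 else memoryless (mainChannel W) x y

/-- The joint law `p(m, zⁿ)` of a uniformly distributed message and of the eavesdropper's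
observation. -/
def leakLaw (c : WiretapCode 𝒳 𝒴 n) (W : 𝒳 → 𝒴 × 𝒵 → ℝ) (mz : Fin c.K × (Fin n → 𝒵)) : ℝ :=
  (1 / (c.K : ℝ)) * ∑ x, c.enc mz.1 x * memoryless (tapChannel W) x mz.2

/-- The ideal law `p^U(m) q(zⁿ)`, where `q(zⁿ) = ∏ᵢ p(zᵢ)` and `p(z) = ∑ₓ p(x) p(z|x)`. -/
def idealLaw (c : WiretapCode 𝒳 𝒴 n) (p : 𝒳 → ℝ) (W : 𝒳 → 𝒴 × 𝒵 → ℝ)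
    (mz : Fin c.K × (Fin n → 𝒵)) : ℝ :=
  (1 / (c.K : ℝ)) * iidLaw (sndLaw (joint p (tapChannel W))) mz.2

/-- The leakage of order `α`: the divergence of `p(m, zⁿ)` from `p^U(m) q(zⁿ)`. -/
def leakage (c : WiretapCode 𝒳 𝒴 n) (α : ℝ≥0∞) (p : 𝒳 → ℝ) (W : 𝒳 → 𝒴 × 𝒵 → ℝ) : EReal :=
  secrecyDiv α (c.leakLaw W) (c.idealLaw p W)

end WiretapCode

/-- The rate `R` is securely achievable under the secrecy criterion of order `α`: there are codes
with at least `2^(nR)` messages whose error probability and leakage tend to zero. -/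
def SecurelyAchievable (α : ℝ≥0∞) (p : 𝒳 → ℝ) (W : 𝒳 → 𝒴 × 𝒵 → ℝ) (R : ℝ) : Prop :=
  ∃ c : ∀ n : ℕ, WiretapCode 𝒳 𝒴 n,
    (∀ᶠ n : ℕ in atTop, (2 : ℝ) ^ ((n : ℝ) * R) ≤ (c n).K) ∧
    Tendsto (fun n => (c n).errorProb W) atTop (𝓝 0) ∧
    Tendsto (fun n => (c n).leakage α p W) atTop (𝓝 0)

/-! ### Codes from random binning of i.i.d. sequences -/

/-- A binning of `𝒳ⁿ` with two bin indices `(m, f) ∈ [M₁] × [M₂]`. -/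
abbrev Binning (𝒳 : Type*) (n M₁ M₂ : ℕ) := (Fin n → 𝒳) → Fin M₁ × Fin M₂

/-- The conditional law `P(xⁿ | m, f)` of an i.i.d. sequence given its two bin indices. -/
def binEncoder (p : 𝒳 → ℝ) {n M₁ M₂ : ℕ} (β : Binning 𝒳 n M₁ M₂) (f : Fin M₂) (m : Fin M₁)
    (x : Fin n → 𝒳) : ℝ :=
  (if β x = (m, f) then iidLaw p x else 0) /
    ∑ x' : Fin n → 𝒳, if β x' = (m, f) then iidLaw p x' else 0

/-- The pair `(β, f)` yields a good code: at least half of the `M₁` bin indices, and at least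
`2^(nR)` of them, can be used as messages in such a way that the code which sends message `m` as a
random word with law `P(xⁿ | m, f)` has, for a suitable decoder, error probability and leakage at
most `δ`. -/
def GoodPair (α : ℝ≥0∞) (p : 𝒳 → ℝ) (W : 𝒳 → 𝒴 × 𝒵 → ℝ) (R δ : ℝ) {n M₁ M₂ : ℕ}
    (β : Binning 𝒳 n M₁ M₂) (f : Fin M₂) : Prop :=
  ∃ (c : WiretapCode 𝒳 𝒴 n) (ι : Fin c.K ↪ Fin M₁),
    (∀ m, c.enc m = binEncoder p β f (ι m)) ∧
    M₁ ≤ 2 * c.K ∧ (2 : ℝ) ^ ((n : ℝ) * R) ≤ c.K ∧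
    c.errorProb W ≤ δ ∧ c.leakage α p W ≤ (δ : EReal)

open Classical in
/-- The probability that `(β, F)` is good, where the binning `β` is uniformly random (every
sequence is assigned to a pair of bins uniformly and independently) and `F` is the second bin index
of an i.i.d. sequence `Xⁿ` with law `∏ᵢ p(xᵢ)`, independent of `β`. -/
def goodProb (α : ℝ≥0∞) (p : 𝒳 → ℝ) (W : 𝒳 → 𝒴 × 𝒵 → ℝ) (R δ : ℝ) (n M₁ M₂ : ℕ) : ℝ :=
  (∑ β : Binning 𝒳 n M₁ M₂, ∑ x : Fin n → 𝒳,
      iidLaw p x * (if GoodPair α p W R δ β (β x).2 then 1 else 0)) /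
    Fintype.card (Binning 𝒳 n M₁ M₂)

/-- The rate `R` is achieved by random binning of i.i.d. sequences: for suitable binning rates
`R₁, R₂ > 0` and every tolerance `δ > 0`, the random binning into `⌊2^(nR₁)⌋ × ⌊2^(nR₂)⌋` bins
yields a good code with probability tending to one. -/
def AchievedByIIDBinning (α : ℝ≥0∞) (p : 𝒳 → ℝ) (W : 𝒳 → 𝒴 × 𝒵 → ℝ) (R : ℝ) : Prop :=
  ∃ R₁ R₂ : ℝ, 0 < R₁ ∧ 0 < R₂ ∧ ∀ δ : ℝ, 0 < δ →
    Tendsto (fun n : ℕ => goodProb α p W R δ n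
      ⌊(2 : ℝ) ^ ((n : ℝ) * R₁)⌋₊ ⌊(2 : ℝ) ^ ((n : ℝ) * R₂)⌋₊) atTop (𝓝 1)

end Codes

end Wiretap

end

set_option linter.unusedSectionVars false

noncomputable section

namespace Wiretap

open scoped BigOperators

/-! Let `B` be the mass of a bin, normalized to have mean one over the random binning, and `B_z` the
same mass computed from the posterior `P(·|z)`. Given its two bin indices, a source sequence
produces an eavesdropper output whose density relative to `q` is `B_z / B`. Secrecy is therefore a
statement about bin masses: for finite `α`, that `U = E_Z B_Z^α` is close to `B^α`; for `α = ∞`,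
that no `B_z` exceeds `2^δ B`.

For finite `α`, splitting off one factor of `B_z^(s+1)` bounds the moment of order `s + 1` by that
of order `s` plus a multiple of `E (N P(X|Z))^s`, with `N` the number of bins
(`expect_binMass_rpow_le`, `MomentRecursion.exists_le`). So `E U` is near one when `E (N
P(X|Z))^(α-1)` is small, and over blocks this decays exponentially if the total binning rate is
below the Rényi entropy. Since `B^α ≤ U` and `E B = 1`, the nonnegative excess `U - 1 - α (B - 1)`
has small mean; Markov's inequality and stability in Bernoulli's inequality make most bins good. For
`α = ∞`, a doubly exponential Chernoff tail absorbs a union bound over all `z`.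

Reliability is source coding with side information: a maximum a posteriori decoder recovers `m` from
`f` and the output if the second binning rate exceeds `H(X|Y)` (`expect_decodingError_le`). The
first rate is taken slightly above `R`, so that for a typical `f` the bad `m` can be discarded
(`goodPair_of_goodBins`, `sum_goodPair_ge`).

The comparison with typical sequences is Jensen's inequality for the logarithm over `x`
(`condRenyiEntropy_le`). -/

lemma one_lt_toReal {α : ℝ≥0∞} (hα : 1 < α) (hα' : α ≠ ⊤) : 1 < α.toReal := by
  rw [← ENNReal.toReal_one]; exact (ENNReal.toReal_lt_toReal (by simp) hα').2 hα

/-! ### Moments and tails of the mass of a random bin -/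

section Binning

variable {X B : Type*} [Fintype X] [Fintype B] [DecidableEq B]

/-- The mass `∑ c x` over the sequences `x` in bin `b`, normalized by the number of bins. -/
def binMass (c : X → ℝ) (β : X → B) (b : B) : ℝ :=
  (Fintype.card B : ℝ) * ∑ x, if β x = b then c x else 0

lemma binMass_nonneg {c : X → ℝ} (hc : ∀ x, 0 ≤ c x) (β : X → B) (b : B) :
    0 ≤ binMass c β b :=
  mul_nonneg (Nat.cast_nonneg _) (Finset.sum_nonneg fun x _ => by split_ifs <;> simp [hc])

variable [DecidableEq X]

/-- Resampling one coordinate of a uniformly random function does not change its law. -/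
lemma expect_update (x : X) (f : (X → B) → ℝ) :
    𝔼 β, f β = 𝔼 β : X → B, 𝔼 v, f (Function.update β x v) := by
  rcases isEmpty_or_nonempty B with hB | hB
  · have : Nonempty X := ⟨x⟩
    have : IsEmpty (X → B) := ⟨fun g => hB.elim (g x)⟩
    simp
  simp only [Fintype.expect_eq_sum_div_card, ← Finset.sum_div]
  have hc : (Fintype.card B : ℝ) ≠ 0 := by positivity
  have key : ∑ β : X → B, ∑ v, f (Function.update β x v) = Fintype.card B * ∑ β, f β := by
    have e : ∀ g : (X → B) → ℝ, ∑ β, g β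
        = ∑ γ : {j // j ≠ x} → B, ∑ v, g ((Equiv.funSplitAt x B).symm (v, γ)) := by
      intro g
      rw [← (Equiv.funSplitAt x B).symm.sum_comp, Fintype.sum_prod_type_right]
    rw [e, e, Finset.mul_sum]
    refine Finset.sum_congr rfl fun γ _ => ?_
    have : ∀ v' v : B, Function.update ((Equiv.funSplitAt x B).symm (v', γ)) x v
        = (Equiv.funSplitAt x B).symm (v, γ) := by
      intro v' v
      ext1 j
      by_cases h : j = x
      · subst h; simp [Equiv.funSplitAt, Equiv.piSplitAt]
      · simp [Equiv.funSplitAt, Equiv.piSplitAt, h]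
    simp only [this]
    simp
  rw [key]
  field_simp

/-- The coordinates of a uniformly random function are independent. -/
lemma expect_prod (h : X → B → ℝ) :
    𝔼 β : X → B, ∏ x, h x (β x) = ∏ x, 𝔼 v, h x v := by
  simp only [Fintype.expect_eq_sum_div_card, Finset.prod_div_distrib]
  rw [Finset.prod_univ_sum]
  simp [Fintype.piFinset_univ]

lemma expect_coord (x : X) (h : B → ℝ) : 𝔼 β : X → B, h (β x) = 𝔼 v, h v := by
  rcases isEmpty_or_nonempty B with hB | hB
  · have : Nonempty X := ⟨x⟩
    have : IsEmpty (X → B) := ⟨fun g => hB.elim (g x)⟩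
    simp
  rw [expect_update x]
  simp

variable [Nonempty B]

lemma expect_ite_coord (x : X) (b : B) (a : ℝ) :
    𝔼 β : X → B, (if β x = b then a else 0) = a / Fintype.card B := by
  rw [expect_coord x (fun v => if v = b then a else 0)]
  rw [Fintype.expect_eq_sum_div_card]
  simp

lemma expect_binMass (c : X → ℝ) (b : B) : 𝔼 β, binMass c β b = ∑ x, c x := by
  have hc : (Fintype.card B : ℝ) ≠ 0 := by positivity
  simp only [binMass]
  rw [← Finset.mul_expect, Finset.expect_sum_comm]
  simp only [expect_ite_coord]
  rw [← Finset.sum_div]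
  field_simp

/-- The probability that two given points are in bins with the same label. -/
lemma expect_ite_coord_eq {L : Type*} [Fintype L] [DecidableEq L] (φ : B → L) {x x' : X}
    (hx : x' ≠ x) :
    𝔼 β : X → B, (if φ (β x') = φ (β x) then (1 : ℝ) else 0)
      = 𝔼 u : B, 𝔼 v : B, if φ v = φ u then (1 : ℝ) else 0 := by
  rw [expect_update x']
  simp only [Function.update_self, Function.update_of_ne hx.symm]
  exact expect_coord x (fun u => 𝔼 v : B, if φ v = φ u then (1 : ℝ) else 0)

/-- A function that ignores coordinate `x` is independent of the event that `x` lands in bin `b`. -/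
lemma expect_ite_mul_of_update_invariant (x : X) (b : B) (h : (X → B) → ℝ)
    (hh : ∀ β v, h (Function.update β x v) = h β) :
    𝔼 β : X → B, (if β x = b then h β else 0) = (𝔼 β, h β) / Fintype.card B := by
  rw [expect_update x, Finset.expect_div]
  refine Finset.expect_congr rfl fun β _ => ?_
  simp only [Function.update_self, hh]
  rw [Fintype.expect_eq_sum_div_card]
  simp

/-- Either `a ≤ ε b` or `b ≤ a / ε`, and one term suffices in each case. The coefficient of `b ^ s`
can be taken near one, at the price of a large one for `a ^ s`. -/
lemma add_rpow_le_of_pos {a b ε s : ℝ} (ha : 0 ≤ a) (hb : 0 ≤ b) (hε : 0 < ε) (hs : 0 ≤ s) :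
    (a + b) ^ s ≤ (1 + ε) ^ s * b ^ s + (1 + 1 / ε) ^ s * a ^ s := by
  rw [← Real.mul_rpow (by positivity) hb, ← Real.mul_rpow (by positivity) ha]
  have h1 : 0 ≤ ((1 + ε) * b) ^ s := by positivity
  have h2 : 0 ≤ ((1 + 1 / ε) * a) ^ s := by positivity
  rcases le_total a (ε * b) with h | h
  · have := Real.rpow_le_rpow (by positivity) (show a + b ≤ (1 + ε) * b by linarith) hs
    linarith
  · have h3 : b ≤ 1 / ε * a := by
      rw [div_mul_eq_mul_div, le_div_iff₀ hε]; linarith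
    have := Real.rpow_le_rpow (by positivity) (show a + b ≤ (1 + 1 / ε) * a by linarith) hs
    linarith

/-- The moment recursion for the mass of a random bin. -/
lemma expect_binMass_rpow_le {c : X → ℝ} (hc : ∀ x, 0 ≤ c x) (hc1 : ∑ x, c x ≤ 1) (b : B)
    {s ε : ℝ} (hs : 0 < s) (hε : 0 < ε) :
    𝔼 β, binMass c β b ^ (s + 1) ≤ (1 + ε) ^ s * 𝔼 β, binMass c β b ^ s
      + (1 + 1 / ε) ^ s * ∑ x, c x * (Fintype.card B * c x) ^ s := by
  set N : ℝ := (Fintype.card B : ℝ) with hN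
  have hN0 : 0 < N := by rw [hN]; positivity
  -- The mass of the bin without `x`. It does not depend on `β x`, and differs from the full mass by
  -- `N * c x` when `x` is in the bin.
  let S' : X → (X → B) → ℝ := fun x β => N * ∑ y, if β y = b ∧ y ≠ x then c y else 0
  have hS'0 : ∀ x β, 0 ≤ S' x β := fun x β =>
    mul_nonneg hN0.le (Finset.sum_nonneg fun y _ => by split_ifs <;> simp [hc])
  have hS'le : ∀ x β, S' x β ≤ binMass c β b := fun x β => by
    refine mul_le_mul_of_nonneg_left (Finset.sum_le_sum fun y _ => ?_) hN0.le
    split_ifs <;> first | exact le_rfl | exact hc _ | tauto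
  have hS'eq : ∀ x β, β x = b → binMass c β b = N * c x + S' x β := fun x β h => by
    simp only [binMass, S', ← hN, ← mul_add]
    congr 1
    rw [← Finset.sum_filter, ← Finset.sum_filter,
      ← Finset.add_sum_erase _ c (by simpa using h : x ∈ Finset.univ.filter (fun y => β y = b))]
    congr 1
    refine Finset.sum_congr ?_ fun _ _ => rfl
    ext y; simp [and_comm]
  have hS'inv : ∀ x β v, S' x (Function.update β x v) = S' x β := fun x β v => by
    simp only [S']
    congr 1
    refine Finset.sum_congr rfl fun y _ => ?_
    by_cases h2 : y = x <;> simp [h2]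
  -- One of the `s + 1` factors is expanded as a sum over the members `x` of the bin; the remaining
  -- power is split into the part without `x` and the part of `x` alone.
  have hpt : ∀ β, binMass c β b ^ (s + 1) ≤ ∑ x, N * c x * (if β x = b then
      ((1 + ε) ^ s * S' x β ^ s + (1 + 1 / ε) ^ s * (N * c x) ^ s) else 0) := by
    intro β
    rw [Real.rpow_add_one' (binMass_nonneg hc _ _) (by linarith), mul_comm]
    conv_lhs => enter [1]; rw [binMass, ← hN, Finset.mul_sum]
    rw [Finset.sum_mul]
    refine Finset.sum_le_sum fun x _ => ?_
    by_cases h : β x = b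
    · simp only [h, if_true]
      refine mul_le_mul_of_nonneg_left ?_ (mul_nonneg hN0.le (hc x))
      rw [hS'eq x β h]
      exact add_rpow_le_of_pos (mul_nonneg hN0.le (hc x)) (hS'0 _ _) hε hs.le
    · simp [h]
  refine (Finset.expect_le_expect fun β _ => hpt β).trans ?_
  rw [Finset.expect_sum_comm]
  have hterm : ∀ x, 𝔼 β : X → B, N * c x * (if β x = b then
      ((1 + ε) ^ s * S' x β ^ s + (1 + 1 / ε) ^ s * (N * c x) ^ s) else 0)
      ≤ c x * ((1 + ε) ^ s * 𝔼 β, binMass c β b ^ s)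
        + (1 + 1 / ε) ^ s * (c x * (N * c x) ^ s) := by
    intro x
    rw [← Finset.mul_expect, expect_ite_mul_of_update_invariant x b _
      (fun β v => by simp only [hS'inv]), Finset.expect_add_distrib, ← Finset.mul_expect,
      Fintype.expect_const, ← hN]
    have h1 : 𝔼 β, S' x β ^ s ≤ 𝔼 β, binMass c β b ^ s :=
      Finset.expect_le_expect fun β _ => Real.rpow_le_rpow (hS'0 _ _) (hS'le _ _) hs.le
    have h2 := mul_le_mul_of_nonneg_left h1 (mul_nonneg (hc x)
      (show 0 ≤ (1 + ε) ^ s by positivity))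
    have h3 : N * c x * (((1 + ε) ^ s * 𝔼 β, S' x β ^ s + (1 + 1 / ε) ^ s * (N * c x) ^ s) / N)
      = c x * (1 + ε) ^ s * 𝔼 β, S' x β ^ s + (1 + 1 / ε) ^ s * (c x * (N * c x) ^ s) := by
      field_simp
    rw [h3]
    linarith
  refine (Finset.sum_le_sum fun x _ => hterm x).trans ?_
  rw [Finset.sum_add_distrib, ← Finset.sum_mul, ← Finset.mul_sum]
  have h0 : 0 ≤ 𝔼 β : X → B, binMass c β b ^ s :=
    Finset.expect_nonneg fun β _ => Real.rpow_nonneg (binMass_nonneg hc _ _) _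
  exact add_le_add_left (mul_le_of_le_one_left (by positivity) hc1) _

/-- For `s ≤ 1` the power lies below its tangent line at one, and the mean mass is at most one. -/
lemma expect_binMass_rpow_le_one {c : X → ℝ} (hc : ∀ x, 0 ≤ c x) (hc1 : ∑ x, c x ≤ 1) (b : B)
    {s : ℝ} (hs : 0 < s) (hs1 : s ≤ 1) : 𝔼 β, binMass c β b ^ s ≤ 1 := by
  have hpt : ∀ β, binMass c β b ^ s ≤ (1 - s) + s * binMass c β b := fun β => by
    have h0 := binMass_nonneg hc β b
    have := rpow_one_add_le_one_add_mul_self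
      (s := binMass c β b - 1) (by linarith) hs.le hs1
    rw [add_sub_cancel] at this
    linarith
  refine (Finset.expect_le_expect fun β _ => hpt β).trans ?_
  rw [Finset.expect_add_distrib, ← Finset.mul_expect, expect_binMass, Fintype.expect_const]
  nlinarith

/-- Markov's inequality for a uniformly distributed element. -/
lemma expect_ite_le_div {Ω : Type*} [Fintype Ω] {f : Ω → ℝ} (hf : ∀ ω, 0 ≤ f ω) {t : ℝ}
    (ht : 0 < t) (P : Ω → Prop) [DecidablePred P] (hP : ∀ ω, P ω → t ≤ f ω) :
    𝔼 ω, (if P ω then (1 : ℝ) else 0) ≤ (𝔼 ω, f ω) / t := by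
  rw [Finset.expect_div]
  refine Finset.expect_le_expect fun ω _ => ?_
  split_ifs with h
  · rw [le_div_iff₀ ht]; linarith [hP ω h]
  · exact div_nonneg (hf ω) ht.le

/-- Chernoff's bound for the mass of a random bin. -/
lemma expect_binMass_gt_le {c : X → ℝ} (hc : ∀ x, 0 ≤ c x) (hc1 : ∑ x, c x ≤ 1) (b : B)
    {w δ : ℝ} (hw : 0 < w) (hcw : ∀ x, Fintype.card B * c x ≤ w) (hδ : 0 < δ) (hδ1 : δ ≤ 1) :
    𝔼 β, (if 1 + δ ≤ binMass c β b then (1 : ℝ) else 0) ≤ Real.exp (-(δ ^ 2 / (4 * w))) := by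
  set N : ℝ := (Fintype.card B : ℝ) with hN
  have hN0 : 0 < N := by rw [hN]; positivity
  -- With this `t` every exponent `t * (N * c x)` is at most `δ / 2`, so that `exp u ≤ 1 + u + u ^ 2
  -- ≤ 1 + u * (1 + δ / 2)`; the gain is then `t * δ / 2 = δ ^ 2 / (4 * w)`.
  set t : ℝ := δ / (2 * w) with ht
  have ht0 : 0 < t := by positivity
  have htw : t * w = δ / 2 := by rw [ht]; field_simp
  have hmgf : 𝔼 β, Real.exp (t * binMass c β b) ≤ Real.exp (t * (1 + δ / 2)) := by
    have h1 : ∀ β : X → B, Real.exp (t * binMass c β b)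
        = ∏ x, (if β x = b then Real.exp (t * (N * c x)) else 1) := by
      intro β
      rw [binMass, ← hN, Finset.mul_sum, Finset.mul_sum, Real.exp_sum]
      refine Finset.prod_congr rfl fun x _ => ?_
      split_ifs <;> simp
    simp only [h1]
    rw [expect_prod (fun x v => if v = b then Real.exp (t * (N * c x)) else 1)]
    have h2 : ∀ x, 𝔼 v : B, (if v = b then Real.exp (t * (N * c x)) else 1)
        ≤ Real.exp (c x * (t * (1 + δ / 2))) := by
      intro x
      have h3 : 𝔼 v : B, (if v = b then Real.exp (t * (N * c x)) else 1)
          = 1 + (Real.exp (t * (N * c x)) - 1) / N := by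
        have : ∀ v : B, (if v = b then Real.exp (t * (N * c x)) else 1)
            = 1 + (if v = b then Real.exp (t * (N * c x)) - 1 else 0) := by
          intro v; split_ifs <;> ring
        simp only [this]
        rw [Finset.expect_add_distrib, Fintype.expect_const]
        rw [Fintype.expect_eq_sum_div_card]
        simp [hN]
      rw [h3]
      set u := t * (N * c x) with hu
      have hu0 : 0 ≤ u := mul_nonneg ht0.le (mul_nonneg hN0.le (hc x))
      have hu1 : u ≤ δ / 2 := by
        rw [← htw]; exact mul_le_mul_of_nonneg_left (hcw x) ht0.le
      have h4 : Real.exp u ≤ 1 + u + u ^ 2 := by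
        have := Real.abs_exp_sub_one_sub_id_le (x := u) (by rw [abs_of_nonneg hu0]; linarith)
        have := (abs_le.1 this).2
        linarith
      have h5 : (Real.exp u - 1) / N ≤ c x * (t * (1 + δ / 2)) := by
        rw [div_le_iff₀ hN0]
        have : c x * (t * (1 + δ / 2)) * N = u * (1 + δ / 2) := by rw [hu]; ring
        rw [this]
        nlinarith
      have := Real.add_one_le_exp (c x * (t * (1 + δ / 2)))
      linarith
    calc ∏ x, 𝔼 v : B, (if v = b then Real.exp (t * (N * c x)) else 1)
        ≤ ∏ x, Real.exp (c x * (t * (1 + δ / 2))) :=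
          Finset.prod_le_prod (fun x _ => Finset.expect_nonneg fun v _ => by
            split_ifs <;> positivity) fun x _ => h2 x
      _ = Real.exp ((∑ x, c x) * (t * (1 + δ / 2))) := by rw [← Real.exp_sum, Finset.sum_mul]
      _ ≤ _ := Real.exp_le_exp.2 (mul_le_of_le_one_left (by positivity) hc1)
  refine (expect_ite_le_div (f := fun β => Real.exp (t * binMass c β b))
    (fun _ => (Real.exp_pos _).le) (Real.exp_pos (t * (1 + δ))) _ (fun β h =>
    Real.exp_le_exp.2 (mul_le_mul_of_nonneg_left h ht0.le))).trans ?_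
  rw [div_le_iff₀ (Real.exp_pos _), ← Real.exp_add]
  refine hmgf.trans (Real.exp_le_exp.2 (le_of_eq ?_))
  rw [ht]
  field_simp
  ring

end Binning

/-! ### Solving the moment recursion; stability in Bernoulli's inequality -/

section Recursion

/-- The moment recursion `u (s + 1) ≤ (1 + ε)^s u s + (1 + 1/ε)^s g s` keeps the moments `u`
close to one as long as the perturbations `g` are small. -/
structure MomentRecursion (u g : ℝ → ℝ) : Prop where
  nonneg : ∀ s, 0 ≤ g s
  le_one : ∀ s, 0 < s → s ≤ 1 → u s ≤ 1
  succ_le : ∀ s ε, 0 < s → 0 < ε → u (s + 1) ≤ (1 + ε) ^ s * u s + (1 + 1 / ε) ^ s * g s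
  le_rpow : ∀ s t, 0 < s → s ≤ t → g s ≤ g t ^ (s / t)

/-- Induction in unit steps, starting from orders in `(0, 1]`. The threshold `δ` is chosen before
`u` and `g`, so it can serve all block lengths at once. -/
lemma MomentRecursion.exists_le_aux (k : ℕ) : ∀ s : ℝ, 0 < s → s ≤ k → ∀ η : ℝ, 0 < η →
    ∃ δ > 0, ∀ u g, MomentRecursion u g → (1 < s → g (s - 1) ≤ δ) → u s ≤ 1 + η := by
  induction k with
  | zero => intro s hs hs'; simp at hs'; linarith
  | succ k ih =>
    intro s hs hsk η hη
    rcases le_or_gt s 1 with hs1 | hs1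
    · exact ⟨1, one_pos, fun u g h _ => (h.le_one s hs hs1).trans (by linarith)⟩
    obtain ⟨t, rfl⟩ : ∃ t, s = t + 1 := ⟨s - 1, by ring⟩
    have ht : 0 < t := by linarith
    -- Since `e ≤ 1`, the final estimate closes: `(1 + e/4)^2 + e/4 ≤ 1 + e`.
    set e := min η 1 with he
    have he0 : 0 < e := lt_min hη one_pos
    have he1 : e ≤ 1 := min_le_right _ _
    have heη : e ≤ η := min_le_left _ _
    obtain ⟨δ₁, hδ₁, H⟩ := ih t ht (by push_cast at hsk; linarith) (e / 4) (by positivity)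
    set ε := (1 + e / 4) ^ (1 / t) - 1 with hε
    have hε0 : 0 < ε := by
      have := Real.one_lt_rpow (show 1 < 1 + e / 4 by linarith) (show 0 < 1 / t by positivity)
      linarith
    have hεt : (1 + ε) ^ t = 1 + e / 4 := by
      rw [hε, add_sub_cancel, ← Real.rpow_mul (by positivity), one_div_mul_cancel ht.ne',
        Real.rpow_one]
    set C := (1 + 1 / ε) ^ t with hC
    have hC0 : 0 < C := by positivity
    -- The first bound controls the perturbation in this step. The second, through `le_rpow`, gives
    -- the hypothesis at order `t - 1` for the inductive call; it is used only if `1 < t`.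
    refine ⟨min (e / 4 / C) (δ₁ ^ (t / (t - 1))),
      lt_min (by positivity) (Real.rpow_pos_of_pos hδ₁ _), fun u g h hg => ?_⟩
    have hg' := hg hs1
    rw [add_sub_cancel_right] at hg'
    have h1 : u t ≤ 1 + e / 4 := by
      refine H u g h fun ht1 => ?_
      have ht1' : 0 < t - 1 := by linarith
      calc g (t - 1) ≤ g t ^ ((t - 1) / t) := h.le_rpow _ _ ht1' (by linarith)
        _ ≤ (δ₁ ^ (t / (t - 1))) ^ ((t - 1) / t) :=
            Real.rpow_le_rpow (h.nonneg _) (hg'.trans (min_le_right _ _)) (by positivity)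
        _ = δ₁ := by
            rw [← Real.rpow_mul hδ₁.le,
              show t / (t - 1) * ((t - 1) / t) = 1 by field_simp, Real.rpow_one]
    have h2 : C * g t ≤ e / 4 := by
      have := hg'.trans (min_le_left _ _)
      rwa [le_div_iff₀ hC0, mul_comm] at this
    have h3 := h.succ_le t ε ht hε0
    rw [hεt] at h3
    nlinarith

lemma MomentRecursion.exists_le {α η : ℝ} (hα : 1 < α) (hη : 0 < η) :
    ∃ δ > 0, ∀ u g, MomentRecursion u g → g (α - 1) ≤ δ → u α ≤ 1 + η := by
  obtain ⟨k, hk⟩ := exists_nat_ge α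
  obtain ⟨δ, hδ, H⟩ := MomentRecursion.exists_le_aux k α (by linarith) hk η hη
  exact ⟨δ, hδ, fun u g h hg => H u g h fun _ => hg⟩

/-- Stability in Bernoulli's inequality `1 + α (B - 1) ≤ B^α ≤ U`: if `U` is close to
`1 + α (B - 1)`, then `B` is not much below one and `U` is close to `B^α`. -/
lemma exists_bernoulli_stability {α ε δ : ℝ} (hα : 1 < α) (hε : 0 < ε) (hε1 : ε < 1)
    (hδ : 0 < δ) : ∃ η > 0, ∀ B U : ℝ, 0 ≤ B → B ^ α ≤ U → U - 1 - α * (B - 1) < η →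
      1 - ε ≤ B ∧ U ≤ (1 + δ) * B ^ α := by
  set b := 1 - ε with hb
  have hb0 : 0 < b := by linarith
  have h1 : 0 < b ^ α - 1 - α * (b - 1) := by
    have := one_add_mul_self_lt_rpow_one_add (s := -ε) (by linarith) (by linarith) hα
    rw [← sub_eq_add_neg, ← hb] at this
    have h2 : b - 1 = -ε := by linarith
    rw [h2]; linarith
  -- The Bernoulli gap at `b = 1 - ε` excludes `B < b`, because the gap decreases on `[0, 1]`; the
  -- second bound turns an additive error into a relative one, as `b ^ α ≤ B ^ α`.
  refine ⟨min (b ^ α - 1 - α * (b - 1)) (δ * b ^ α), lt_min h1 (by positivity),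
    fun B U hB hBU hU => ?_⟩
  have hU1 := hU.trans_le (min_le_left _ _)
  have hU2 := hU.trans_le (min_le_right _ _)
  have hbB : b ≤ B := by
    by_contra! hlt
    -- The tangent line of the power at `b`, obtained by rescaling Bernoulli's inequality; its slope
    -- is at most `α`.
    have h3 : b ^ α * (1 + α * (B / b - 1)) ≤ B ^ α := by
      have := one_add_mul_self_le_rpow_one_add (s := B / b - 1)
        (by have : 0 ≤ B / b := by positivity
            linarith) hα.le
      rw [add_sub_cancel, Real.div_rpow hB hb0.le, le_div_iff₀ (by positivity)] at this
      linarith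
    have h4 : b ^ α * (1 + α * (B / b - 1)) = b ^ α + b ^ α / b * (α * (B - b)) := by
      field_simp
    have h5 : b ^ α / b ≤ 1 := by
      rw [div_le_one hb0]
      exact Real.rpow_le_self_of_le_one hb0.le (by linarith) hα.le
    have h6 := mul_le_mul_of_nonpos_right h5 (show α * (B - b) ≤ 0 by nlinarith)
    linarith
  refine ⟨hbB, ?_⟩
  have h6 : b ^ α ≤ B ^ α := Real.rpow_le_rpow hb0.le hbB (by linarith)
  have h7 : 1 + α * (B - 1) ≤ B ^ α := by
    have := one_add_mul_self_le_rpow_one_add (s := B - 1) (by linarith) hα.le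
    rwa [add_sub_cancel] at this
  nlinarith

end Recursion

/-! ### Most bins are good for secrecy -/

section Secrecy

/-- `J` is the joint probability mass function of a pair. -/
structure IsJointLaw {X Z : Type*} [Fintype X] [Fintype Z] (J : X → Z → ℝ) : Prop where
  nonneg : ∀ x z, 0 ≤ J x z
  sum_eq_one : ∑ x, ∑ z, J x z = 1

section JointLaw

variable {X Z : Type*} [Fintype X] [Fintype Z] {J : X → Z → ℝ}

namespace IsJointLaw

lemma sndLaw_nonneg (hJ : IsJointLaw J) (z : Z) : 0 ≤ sndLaw J z :=
  Finset.sum_nonneg fun x _ => hJ.nonneg x z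

lemma fstLaw_nonneg (hJ : IsJointLaw J) (x : X) : 0 ≤ fstLaw J x :=
  Finset.sum_nonneg fun z _ => hJ.nonneg x z

lemma sum_fstLaw (hJ : IsJointLaw J) : ∑ x, fstLaw J x = 1 := hJ.sum_eq_one

lemma sum_sndLaw (hJ : IsJointLaw J) : ∑ z, sndLaw J z = 1 := by
  rw [← hJ.sum_eq_one, Finset.sum_comm]; rfl

lemma condProb_nonneg (hJ : IsJointLaw J) (x : X) (z : Z) : 0 ≤ condProb J x z :=
  div_nonneg (hJ.nonneg x z) (hJ.sndLaw_nonneg z)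

lemma eq_zero_of_sndLaw (hJ : IsJointLaw J) {z : Z} (hz : sndLaw J z = 0) (x : X) : J x z = 0 :=
  (Finset.sum_eq_zero_iff_of_nonneg fun x _ => hJ.nonneg x z).1 hz x (Finset.mem_univ x)

lemma sndLaw_mul_condProb (hJ : IsJointLaw J) (x : X) (z : Z) :
    sndLaw J z * condProb J x z = J x z := by
  by_cases hz : sndLaw J z = 0
  · rw [hz, zero_mul, hJ.eq_zero_of_sndLaw hz]
  · exact mul_div_cancel₀ _ hz

lemma sum_condProb_le_one (z : Z) : ∑ x, condProb J x z ≤ 1 := by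
  simp only [condProb, ← Finset.sum_div]
  exact div_self_le_one _

end IsJointLaw

/-- The moment `E (N P(X|Z))^s`; for `N = 1` it is `2^(-s H̃_{1+s}(X|Z))`. -/
def condMoment (N : ℝ) (J : X → Z → ℝ) (s : ℝ) : ℝ :=
  ∑ x, ∑ z, J x z * (N * condProb J x z) ^ s

lemma condMoment_nonneg (hJ : IsJointLaw J) {N : ℝ} (hN : 0 ≤ N) (s : ℝ) :
    0 ≤ condMoment N J s :=
  Finset.sum_nonneg fun x _ => Finset.sum_nonneg fun z _ => mul_nonneg (hJ.nonneg x z)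
    (Real.rpow_nonneg (mul_nonneg hN (hJ.condProb_nonneg x z)) _)

/-- Lyapunov's inequality. -/
lemma condMoment_le_rpow (hJ : IsJointLaw J) {N : ℝ} (hN : 0 ≤ N) {s t : ℝ} (hs : 0 < s)
    (hst : s ≤ t) : condMoment N J s ≤ condMoment N J t ^ (s / t) := by
  have ht : 0 < t := hs.trans_le hst
  have h0 : ∀ x z, 0 ≤ N * condProb J x z := fun x z => mul_nonneg hN (hJ.condProb_nonneg x z)
  have h1 : condMoment N J s ^ (t / s) ≤ condMoment N J t := by
    have := Real.rpow_arith_mean_le_arith_mean_rpow (Finset.univ : Finset (X × Z))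
      (fun a => J a.1 a.2) (fun a => (N * condProb J a.1 a.2) ^ s) (fun a _ => hJ.nonneg _ _)
      (by rw [Fintype.sum_prod_type]; exact hJ.sum_eq_one)
      (fun a _ => Real.rpow_nonneg (h0 _ _) _) (p := t / s) ((one_le_div hs).2 hst)
    simp only [← Real.rpow_mul (h0 _ _), mul_div_cancel₀ _ hs.ne', Fintype.sum_prod_type] at this
    exact this
  have h2 := Real.rpow_le_rpow (Real.rpow_nonneg (condMoment_nonneg hJ hN s) _) h1
    (show 0 ≤ s / t by positivity)
  rwa [← Real.rpow_mul (condMoment_nonneg hJ hN s),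
    show t / s * (s / t) = 1 by field_simp, Real.rpow_one] at h2

lemma condMoment_one_le (hJ : IsJointLaw J) {N w : ℝ} (hw : ∀ x z, N * condProb J x z ≤ w) :
    condMoment N J 1 ≤ w := by
  calc condMoment N J 1 ≤ ∑ x, ∑ z, J x z * w := Finset.sum_le_sum fun x _ =>
        Finset.sum_le_sum fun z _ => by
          rw [Real.rpow_one]
          exact mul_le_mul_of_nonneg_left (hw x z) (hJ.nonneg x z)
    _ = w := by simp only [← Finset.sum_mul]; rw [hJ.sum_eq_one, one_mul]

end JointLaw

section Bins

variable {X Z B : Type*} [Fintype X] [Fintype Z] [Fintype B] [DecidableEq B]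

/-- The moment `E_Z (P(b|Z) N)^α` of the normalized mass of bin `b`. -/
def binMoment (J : X → Z → ℝ) (β : X → B) (b : B) (α : ℝ) : ℝ :=
  ∑ z, sndLaw J z * binMass (fun x => condProb J x z) β b ^ α

variable {J : X → Z → ℝ}

lemma sum_sndLaw_mul_binMass (hJ : IsJointLaw J) (β : X → B) (b : B) :
    ∑ z, sndLaw J z * binMass (fun x => condProb J x z) β b = binMass (fstLaw J) β b := by
  simp only [binMass, Finset.mul_sum, fstLaw]
  rw [Finset.sum_comm]
  refine Finset.sum_congr rfl fun x _ => ?_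
  split_ifs
  · rw [Finset.mul_sum]
    exact Finset.sum_congr rfl fun z _ => by rw [← hJ.sndLaw_mul_condProb x z]; ring
  · simp

/-- Jensen's inequality: the unconditional bin mass is the average over `z` of the conditional ones.
-/
lemma binMass_rpow_le_binMoment (hJ : IsJointLaw J) (β : X → B) (b : B) {α : ℝ} (hα : 1 ≤ α) :
    binMass (fstLaw J) β b ^ α ≤ binMoment J β b α := by
  rw [← sum_sndLaw_mul_binMass hJ]
  exact Real.rpow_arith_mean_le_arith_mean_rpow _ _ _ (fun z _ => hJ.sndLaw_nonneg z)
    hJ.sum_sndLaw (fun z _ => binMass_nonneg (fun x => hJ.condProb_nonneg x z) _ _) hα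

variable [DecidableEq X] [Nonempty B]

/-- The recursion holds for each posterior `P(·|z)` and is averaged over `z`; since `P(z) P(x|z) = J
x z`, the perturbations add up to `condMoment`. -/
lemma momentRecursion_binMoment (hJ : IsJointLaw J) (b : B) :
    MomentRecursion (fun s => 𝔼 β : X → B, binMoment J β b s)
      (condMoment (Fintype.card B) J) where
  nonneg := condMoment_nonneg hJ (Nat.cast_nonneg _)
  le_one s hs hs1 := by
    simp only [binMoment]
    rw [Finset.expect_sum_comm, ← hJ.sum_sndLaw]
    refine Finset.sum_le_sum fun z _ => ?_
    rw [← Finset.mul_expect]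
    exact mul_le_of_le_one_right (hJ.sndLaw_nonneg z) (expect_binMass_rpow_le_one
      (fun x => hJ.condProb_nonneg x z) (IsJointLaw.sum_condProb_le_one z) b hs hs1)
  succ_le s ε hs hε := by
    simp only [binMoment, condMoment]
    rw [Finset.expect_sum_comm, Finset.expect_sum_comm, Finset.mul_sum, Finset.sum_comm,
      Finset.mul_sum, ← Finset.sum_add_distrib]
    refine Finset.sum_le_sum fun z _ => ?_
    rw [← Finset.mul_expect, ← Finset.mul_expect]
    have := mul_le_mul_of_nonneg_left (expect_binMass_rpow_le
      (fun x => hJ.condProb_nonneg x z) (IsJointLaw.sum_condProb_le_one z) b hs hε)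
      (hJ.sndLaw_nonneg z)
    refine this.trans (le_of_eq ?_)
    rw [mul_add, mul_left_comm, mul_left_comm (sndLaw J z) ((1 + 1 / ε) ^ s), Finset.mul_sum]
    simp only [← mul_assoc, hJ.sndLaw_mul_condProb]
  le_rpow s t hs hst := condMoment_le_rpow hJ (Nat.cast_nonneg _) hs hst

/-- Bin `b` has at least `1 - ε` of the average mass, and given the bin the observation of the
eavesdropper has divergence at most `δ` of order `α` from its unconditional law. -/
def GoodBin (α : ℝ≥0∞) (J : X → Z → ℝ) (ε δ : ℝ) (β : X → B) (b : B) : Prop :=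
  1 - ε ≤ binMass (fstLaw J) β b ∧
  if α = ⊤ then ∀ z, binMass (fun x => condProb J x z) β b ≤ 2 ^ δ * binMass (fstLaw J) β b
  else binMoment J β b α.toReal
    ≤ (1 + (α.toReal - 1) * δ) * binMass (fstLaw J) β b ^ α.toReal

end Bins

universe u v w

open Classical in
-- Markov's inequality for the Bernoulli excess, whose mean is `E U - 1` because the bin mass has
-- mean one. The constant `κ` precedes the types, as these will grow with the block length.
lemma exists_forall_expect_not_stable_le {α ε δ τ : ℝ} (hα : 1 < α) (hε : 0 < ε) (hε1 : ε < 1)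
    (hδ : 0 < δ) (hτ : 0 < τ) : ∃ κ > 0, ∀ (X : Type u) (Z : Type v) (B : Type w) [Fintype X]
      [Fintype Z] [Fintype B] [DecidableEq X] [DecidableEq B] [Nonempty B] (J : X → Z → ℝ),
      IsJointLaw J → condMoment (Fintype.card B) J (α - 1) ≤ κ → ∀ b : B,
        𝔼 β : X → B, (if ¬ (1 - ε ≤ binMass (fstLaw J) β b ∧
          binMoment J β b α ≤ (1 + δ) * binMass (fstLaw J) β b ^ α) then (1 : ℝ) else 0) ≤ τ := by
  obtain ⟨η, hη, H⟩ := exists_bernoulli_stability hα hε hε1 hδ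
  obtain ⟨κ, hκ, K⟩ := MomentRecursion.exists_le hα (mul_pos hτ hη)
  refine ⟨κ, hκ, fun X Z B _ _ _ _ _ _ J hJ hJκ b => ?_⟩
  have hU := K _ _ (momentRecursion_binMoment hJ b) hJκ
  have hB0 : ∀ β : X → B, 0 ≤ binMass (fstLaw J) β b := fun β =>
    binMass_nonneg hJ.fstLaw_nonneg β b
  refine (expect_ite_le_div
    (f := fun β => binMoment J β b α - 1 - α * (binMass (fstLaw J) β b - 1)) (fun β => ?_) hη _
    (fun β h => ?_)).trans ?_
  · have h1 := binMass_rpow_le_binMoment hJ β b hα.le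
    have h2 := one_add_mul_self_le_rpow_one_add (s := binMass (fstLaw J) β b - 1)
      (by linarith [hB0 β]) hα.le
    rw [add_sub_cancel] at h2
    linarith
  · by_contra! hlt
    exact h (H _ _ (hB0 β) (binMass_rpow_le_binMoment hJ β b hα.le) hlt)
  · rw [div_le_iff₀ hη, Finset.expect_sub_distrib, Finset.expect_sub_distrib,
      ← Finset.mul_expect, Finset.expect_sub_distrib, expect_binMass, hJ.sum_fstLaw,
      Fintype.expect_const]
    linarith

open Classical in
lemma exists_forall_expect_not_goodBin_le {α : ℝ≥0∞} {ε δ τ : ℝ} (hα : 1 < α) (hα' : α ≠ ⊤)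
    (hε : 0 < ε) (hε1 : ε < 1) (hδ : 0 < δ) (hτ : 0 < τ) :
    ∃ κ > 0, ∀ (X : Type u) (Z : Type v) (B : Type w) [Fintype X]
      [Fintype Z] [Fintype B] [DecidableEq X] [DecidableEq B] [Nonempty B] (J : X → Z → ℝ),
      IsJointLaw J → condMoment (Fintype.card B) J (α.toReal - 1) ≤ κ → ∀ b : B,
        𝔼 β : X → B, (if ¬ GoodBin α J ε δ β b then (1 : ℝ) else 0) ≤ τ := by
  have hα1 := one_lt_toReal hα hα'
  obtain ⟨κ, hκ, H⟩ := exists_forall_expect_not_stable_le.{u, v, w} hα1 hε hε1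
    (mul_pos (sub_pos.2 hα1) hδ) hτ
  refine ⟨κ, hκ, fun X Z B _ _ _ _ _ _ J hJ hJκ b => ?_⟩
  simpa only [GoodBin, if_neg hα'] using H X Z B J hJ hJκ b

open Classical in
lemma exists_forall_expect_not_goodBin_top_le {ε δ τ : ℝ}
    (hε : 0 < ε) (hε1 : ε < 1) (hδ : 0 < δ) (hτ : 0 < τ) :
    ∃ κ > 0, ∃ θ > 0, ∀ (X : Type u) (Z : Type v) (B : Type w) [Fintype X]
      [Fintype Z] [Fintype B] [DecidableEq X] [DecidableEq B] [Nonempty B] (J : X → Z → ℝ),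
      IsJointLaw J → ∀ r : ℝ, 0 < r → r ≤ κ → Fintype.card Z * Real.exp (-(θ / r)) ≤ κ →
        (∀ x z, Fintype.card B * condProb J x z ≤ r) → ∀ b : B,
        𝔼 β : X → B, (if ¬ GoodBin ⊤ J ε δ β b then (1 : ℝ) else 0) ≤ τ := by
  have h2 : (1 : ℝ) < 2 ^ δ := Real.one_lt_rpow (by norm_num) hδ
  -- With this tolerance, `B_z ≤ 1 + e` and `B ≥ 1 - e` together give `B_z ≤ 2^δ B`.
  obtain ⟨e, he0, heε, heδ⟩ : ∃ e > 0, e ≤ ε ∧ 1 + e ≤ 2 ^ δ * (1 - e) := by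
    refine ⟨min ε ((2 ^ δ - 1) / (2 ^ δ + 1)), lt_min hε (div_pos (by linarith) (by linarith)),
      min_le_left _ _, ?_⟩
    have h3 := min_le_right ε (((2 : ℝ) ^ δ - 1) / (2 ^ δ + 1))
    rw [le_div_iff₀ (by linarith)] at h3
    linarith
  have he1 : e < 1 := heε.trans_lt hε1
  -- The case of order two is used only for its lower bound on the bin mass; the upper bounds come
  -- from Chernoff's bound and a union over `z`.
  obtain ⟨κ, hκ, H⟩ := exists_forall_expect_not_stable_le.{u, v, w} one_lt_two he0 he1
    one_pos (half_pos hτ)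
  refine ⟨min κ (τ / 2), lt_min hκ (half_pos hτ), e ^ 2 / 4, by positivity,
    fun X Z B _ _ _ _ _ _ J hJ r hr hrκ hexp hrJ b => ?_⟩
  have h4 := H X Z B J hJ (by
    rw [show (2 : ℝ) - 1 = 1 by norm_num]
    exact (condMoment_one_le hJ hrJ).trans (hrκ.trans (min_le_left _ _))) b
  have h5 : ∑ z, 𝔼 β : X → B, (if 1 + e ≤ binMass (fun x => condProb J x z) β b
      then (1 : ℝ) else 0) ≤ τ / 2 := by
    refine le_trans ?_ (hexp.trans (min_le_right _ _))
    refine (Finset.sum_le_card_nsmul _ _ (Real.exp (-(e ^ 2 / 4 / r))) fun z _ => ?_).trans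
      (by rw [nsmul_eq_mul]; rfl)
    rw [div_div]
    exact expect_binMass_gt_le (fun x => hJ.condProb_nonneg x z)
      (IsJointLaw.sum_condProb_le_one z) b hr (fun x => hrJ x z) he0 he1.le
  rw [← Finset.expect_sum_comm] at h5
  rw [← add_halves τ]
  refine le_trans ?_ (add_le_add h4 h5)
  rw [← Finset.expect_add_distrib]
  refine Finset.expect_le_expect fun β _ => ?_
  have hz0 : ∀ z, 0 ≤ (if 1 + e ≤ binMass (fun x => condProb J x z) β b then (1 : ℝ) else 0) :=
    fun z => by split_ifs <;> norm_num
  have hs0 := Finset.sum_nonneg fun z (_ : z ∈ Finset.univ) => hz0 z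
  by_cases hb : 1 - e ≤ binMass (fstLaw J) β b ∧
      binMoment J β b 2 ≤ (1 + 1) * binMass (fstLaw J) β b ^ (2 : ℝ)
  · rw [if_neg (not_not.2 hb), zero_add]
    split_ifs with h
    · exact hs0
    · obtain ⟨z, hz⟩ : ∃ z, 1 + e ≤ binMass (fun x => condProb J x z) β b := by
        by_contra! hlt
        refine h ⟨by linarith [hb.1], ?_⟩
        rw [if_pos rfl]
        intro z
        refine (hlt z).le.trans (heδ.trans ?_)
        exact mul_le_mul_of_nonneg_left hb.1 (by positivity)
      refine le_trans ?_ (Finset.single_le_sum (fun z _ => hz0 z) (Finset.mem_univ z))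
      rw [if_pos hz]
  · rw [if_pos hb]
    split_ifs <;> linarith

end Secrecy

/-! ### Source coding with side information at the decoder -/

section SideInformation

variable {X Y I L : Type*} [Nonempty I]

open Classical in
/-- The first bin index of a most likely sequence among those with second bin index `f`, given
the side information `y`. -/
def mapDecoder (J : X → Y → ℝ) (β : X → I × L) (f : L) (y : Y) : I :=
  if h : ∃ x, (β x).2 = f ∧ ∀ x', (β x').2 = f → J x' y ≤ J x y then (β h.choose).1
  else Classical.arbitrary I

variable [Fintype X]

lemma exists_of_mapDecoder_ne {J : X → Y → ℝ} {β : X → I × L} {x : X} {y : Y}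
    (h : mapDecoder J β (β x).2 y ≠ (β x).1) :
    ∃ x', x' ≠ x ∧ (β x').2 = (β x).2 ∧ J x y ≤ J x' y := by
  classical
  have hex : ∃ x₀, (β x₀).2 = (β x).2 ∧ ∀ x', (β x').2 = (β x).2 → J x' y ≤ J x₀ y := by
    obtain ⟨x₀, h1, h2⟩ := Finset.exists_max_image
      (Finset.univ.filter fun x' => (β x').2 = (β x).2) (fun x' => J x' y) ⟨x, by simp⟩
    exact ⟨x₀, by simpa using h1, fun x' hx' => h2 x' (by simpa using hx')⟩
  rw [mapDecoder, dif_pos hex] at h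
  exact ⟨hex.choose, fun he => h (by rw [he]), hex.choose_spec.1, hex.choose_spec.2 x rfl⟩

variable [Fintype Y] [Fintype I] [Fintype L] [DecidableEq I] [DecidableEq L]

/-- The probability of not recovering the first bin index of the source from its second bin index
and the side information. -/
def decodingError (J : X → Y → ℝ) (β : X → I × L) : ℝ :=
  ∑ x, ∑ y, if mapDecoder J β (β x).2 y = (β x).1 then 0 else J x y

variable [DecidableEq X] [Nonempty L] {J : X → Y → ℝ}

/-- An error requires a competitor at least as likely as `x` given `y` with the same second index.
At most `1 / P(x|y)` such sequences exist, each colliding with probability `1 / |L|`; and a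
probability bounded by `v` is at most `v ^ s` for `s` in `[0, 1]`. -/
lemma expect_mapDecoder_ne_le (hJ : IsJointLaw J) {s : ℝ} (hs : 0 ≤ s) (hs1 : s ≤ 1) {x : X}
    {y : Y} (hxy : 0 < J x y) :
    𝔼 β : X → I × L, (if mapDecoder J β (β x).2 y = (β x).1 then (0 : ℝ) else 1)
      ≤ (Fintype.card L * condProb J x y) ^ (-s) := by
  have hL : (0 : ℝ) < Fintype.card L := by positivity
  have hq : 0 < sndLaw J y :=
    hxy.trans_le (Finset.single_le_sum (fun x _ => hJ.nonneg x y) (Finset.mem_univ x))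
  have hc : 0 < Fintype.card L * condProb J x y := mul_pos hL (div_pos hxy hq)
  set E := 𝔼 β : X → I × L, (if mapDecoder J β (β x).2 y = (β x).1 then (0 : ℝ) else 1) with hE
  have hE0 : 0 ≤ E := Finset.expect_nonneg fun β _ => by split_ifs <;> norm_num
  have hE1 : E ≤ 1 := by
    rw [← Fintype.expect_const (ι := X → I × L) (1 : ℝ)]
    exact Finset.expect_le_expect fun β _ => by split_ifs <;> norm_num
  have hcoll : 𝔼 u : I × L, 𝔼 v : I × L, (if v.2 = u.2 then (1 : ℝ) else 0)
      = 1 / Fintype.card L := by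
    have : ∀ u : I × L, 𝔼 v : I × L, (if v.2 = u.2 then (1 : ℝ) else 0)
        = 1 / Fintype.card L := by
      intro u
      rw [Fintype.expect_eq_sum_div_card, Fintype.sum_prod_type, Fintype.card_prod]
      simp
      field_simp
    simp only [this, Fintype.expect_const]
  have hEu : E ≤ (Fintype.card L * condProb J x y)⁻¹ := by
    have h1 : E ≤ ∑ x' ∈ Finset.univ.filter (fun x' => x' ≠ x ∧ J x y ≤ J x' y),
        𝔼 β : X → I × L, (if (β x').2 = (β x).2 then (1 : ℝ) else 0) := by
      rw [← Finset.expect_sum_comm]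
      refine Finset.expect_le_expect fun β _ => ?_
      have h0 : ∀ x', (0 : ℝ) ≤ if (β x').2 = (β x).2 then (1 : ℝ) else 0 :=
        fun x' => by split_ifs <;> norm_num
      split_ifs with h
      · exact Finset.sum_nonneg fun x' _ => h0 x'
      · obtain ⟨x', hne, heq, hle⟩ := exists_of_mapDecoder_ne h
        refine le_trans ?_ (Finset.single_le_sum (fun x' _ => h0 x')
          (show x' ∈ _ by simp [hne, hle]))
        rw [if_pos heq]
    have h2 : ∀ x' ∈ Finset.univ.filter (fun x' => x' ≠ x ∧ J x y ≤ J x' y),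
        𝔼 β : X → I × L, (if (β x').2 = (β x).2 then (1 : ℝ) else 0)
          ≤ J x' y * (1 / Fintype.card L / J x y) := by
      intro x' hx'
      obtain ⟨hne, hle⟩ := (Finset.mem_filter.1 hx').2
      rw [expect_ite_coord_eq Prod.snd hne, hcoll, mul_div_assoc', le_div_iff₀ hxy, mul_comm]
      exact mul_le_mul_of_nonneg_right hle (by positivity)
    refine h1.trans ((Finset.sum_le_sum h2).trans ?_)
    rw [← Finset.sum_mul]
    have h3 : ∑ x' ∈ Finset.univ.filter (fun x' => x' ≠ x ∧ J x y ≤ J x' y), J x' y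
        ≤ sndLaw J y := Finset.sum_le_univ_sum_of_nonneg fun x' => hJ.nonneg x' y
    refine (mul_le_mul_of_nonneg_right h3 (by positivity)).trans (le_of_eq ?_)
    rw [condProb]
    field_simp
  calc E ≤ E ^ s := by
        rcases hE0.eq_or_lt with h | h
        · rw [← h]; exact Real.rpow_nonneg le_rfl _
        · conv_lhs => rw [← Real.rpow_one E]
          exact Real.rpow_le_rpow_of_exponent_ge h hE1 hs1
    _ ≤ ((Fintype.card L * condProb J x y)⁻¹) ^ s := Real.rpow_le_rpow hE0 hEu hs
    _ = _ := by rw [Real.rpow_neg hc.le, Real.inv_rpow hc.le]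

/-- Random binning with side information at the decoder. -/
lemma expect_decodingError_le (hJ : IsJointLaw J) {s : ℝ} (hs : 0 ≤ s) (hs1 : s ≤ 1) :
    𝔼 β : X → I × L, decodingError J β ≤ condMoment (Fintype.card L) J (-s) := by
  simp only [decodingError, condMoment]
  rw [Finset.expect_sum_comm]
  refine Finset.sum_le_sum fun x _ => ?_
  rw [Finset.expect_sum_comm]
  refine Finset.sum_le_sum fun y _ => ?_
  rcases (hJ.nonneg x y).eq_or_lt with h | h
  · simp [← h]
  · have : ∀ β : X → I × L, (if mapDecoder J β (β x).2 y = (β x).1 then 0 else J x y)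
        = J x y * (if mapDecoder J β (β x).2 y = (β x).1 then 0 else 1) := by
      intro β; split_ifs <;> simp
    simp only [this]
    rw [← Finset.mul_expect]
    exact mul_le_mul_of_nonneg_left (expect_mapDecoder_ne_le hJ hs hs1 h) h.le

end SideInformation

/-! ### Product laws and memoryless channels -/

section Blocks

variable {𝒳 ℬ : Type*} [Fintype 𝒳] [Fintype ℬ]

/-- The joint law of `n` independent copies of a pair. -/
def blockLaw (n : ℕ) (J : 𝒳 → ℬ → ℝ) (x : Fin n → 𝒳) (b : Fin n → ℬ) : ℝ := ∏ i, J (x i) (b i)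

lemma sum_prod_eq_prod_sum {κ : Type*} [Fintype κ] {n : ℕ} (h : Fin n → κ → ℝ) :
    ∑ x : Fin n → κ, ∏ i, h i (x i) = ∏ i, ∑ a, h i a := by
  rw [Finset.prod_univ_sum, Fintype.piFinset_univ]

lemma sum_sum_blockLaw (n : ℕ) (J : 𝒳 → ℬ → ℝ) :
    ∑ x, ∑ b, blockLaw n J x b = (∑ x, ∑ b, J x b) ^ n := by
  simp only [blockLaw]
  simp only [fun x : Fin n → 𝒳 => sum_prod_eq_prod_sum fun i b => J (x i) b]
  rw [sum_prod_eq_prod_sum fun _ a => ∑ b, J a b]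
  simp

lemma sndLaw_blockLaw (n : ℕ) (J : 𝒳 → ℬ → ℝ) (b : Fin n → ℬ) :
    sndLaw (blockLaw n J) b = iidLaw (sndLaw J) b :=
  sum_prod_eq_prod_sum fun i x => J x (b i)

lemma fstLaw_blockLaw (n : ℕ) (J : 𝒳 → ℬ → ℝ) (x : Fin n → 𝒳) :
    fstLaw (blockLaw n J) x = iidLaw (fstLaw J) x :=
  sum_prod_eq_prod_sum fun i b => J (x i) b

lemma condProb_blockLaw (n : ℕ) (J : 𝒳 → ℬ → ℝ) (x : Fin n → 𝒳) (b : Fin n → ℬ) :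
    condProb (blockLaw n J) x b = ∏ i, condProb J (x i) (b i) := by
  simp only [condProb, sndLaw_blockLaw, iidLaw, Finset.prod_div_distrib, blockLaw]

lemma IsJointLaw.blockLaw {J : 𝒳 → ℬ → ℝ} (hJ : IsJointLaw J) (n : ℕ) :
    IsJointLaw (blockLaw n J) where
  nonneg _ _ := Finset.prod_nonneg fun _ _ => hJ.nonneg _ _
  sum_eq_one := by rw [sum_sum_blockLaw, hJ.sum_eq_one, one_pow]

lemma condMoment_blockLaw {J : 𝒳 → ℬ → ℝ} (hJ : IsJointLaw J) (n : ℕ) {N : ℝ} (hN : 0 ≤ N)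
    (s : ℝ) : condMoment N (blockLaw n J) s = N ^ s * condMoment 1 J s ^ n := by
  have h1 : condMoment 1 J s = ∑ x, ∑ b, J x b * condProb J x b ^ s := by
    simp only [condMoment, one_mul]
  rw [h1, ← sum_sum_blockLaw, Finset.mul_sum]
  refine Finset.sum_congr rfl fun x _ => ?_
  rw [Finset.mul_sum]
  refine Finset.sum_congr rfl fun b _ => ?_
  rw [condProb_blockLaw, Real.mul_rpow hN (Finset.prod_nonneg fun _ _ => hJ.condProb_nonneg _ _),
    ← Real.finsetProd_rpow _ _ fun _ _ => hJ.condProb_nonneg _ _]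
  simp only [Wiretap.blockLaw, Finset.prod_mul_distrib]
  ring

lemma blockLaw_joint (n : ℕ) (p : 𝒳 → ℝ) (V : 𝒳 → ℬ → ℝ) (x : Fin n → 𝒳) (b : Fin n → ℬ) :
    blockLaw n (joint p V) x b = iidLaw p x * memoryless V x b :=
  Finset.prod_mul_distrib

lemma isJointLaw_joint {p : 𝒳 → ℝ} (hp : p ∈ stdSimplex ℝ 𝒳) {V : 𝒳 → ℬ → ℝ}
    (hV : ∀ x, V x ∈ stdSimplex ℝ ℬ) : IsJointLaw (joint p V) where
  nonneg x b := mul_nonneg (hp.1 x) ((hV x).1 b)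
  sum_eq_one := by
    simp only [joint, ← Finset.mul_sum, (hV _).2, mul_one, hp.2]

lemma fstLaw_joint (p : 𝒳 → ℝ) {V : 𝒳 → ℬ → ℝ} (hV : ∀ x, V x ∈ stdSimplex ℝ ℬ) :
    fstLaw (joint p V) = p := by
  ext x
  simp only [fstLaw, joint, ← Finset.mul_sum, (hV _).2, mul_one]

lemma iidLaw_mem {p : 𝒳 → ℝ} (hp : p ∈ stdSimplex ℝ 𝒳) (n : ℕ) :
    (iidLaw p : (Fin n → 𝒳) → ℝ) ∈ stdSimplex ℝ (Fin n → 𝒳) := by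
  refine ⟨fun x => Finset.prod_nonneg fun _ _ => hp.1 _, ?_⟩
  simp only [iidLaw]
  rw [sum_prod_eq_prod_sum fun _ a => p a]
  simp [hp.2]

lemma memoryless_mem {V : 𝒳 → ℬ → ℝ} (hV : ∀ x, V x ∈ stdSimplex ℝ ℬ) {n : ℕ}
    (x : Fin n → 𝒳) : memoryless V x ∈ stdSimplex ℝ (Fin n → ℬ) := by
  refine ⟨fun b => Finset.prod_nonneg fun _ _ => (hV _).1 _, ?_⟩
  simp only [memoryless]
  rw [sum_prod_eq_prod_sum fun i b => V (x i) b]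
  simp [(hV _).2]

variable {𝒴 𝒵 : Type*} [Fintype 𝒴] [Fintype 𝒵] {W : 𝒳 → 𝒴 × 𝒵 → ℝ}

lemma mainChannel_mem (hW : ∀ x, W x ∈ stdSimplex ℝ (𝒴 × 𝒵)) (x : 𝒳) :
    mainChannel W x ∈ stdSimplex ℝ 𝒴 :=
  ⟨fun _ => Finset.sum_nonneg fun _ _ => (hW x).1 _, by
    rw [← (hW x).2, Fintype.sum_prod_type]; rfl⟩

lemma tapChannel_mem (hW : ∀ x, W x ∈ stdSimplex ℝ (𝒴 × 𝒵)) (x : 𝒳) :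
    tapChannel W x ∈ stdSimplex ℝ 𝒵 :=
  ⟨fun _ => Finset.sum_nonneg fun _ _ => (hW x).1 _, by
    rw [← (hW x).2, Fintype.sum_prod_type_right]; rfl⟩

end Blocks

/-! ### Divergence bounds in terms of a density -/

section Divergence

variable {κ : Type*} [Fintype κ] {P Q r : κ → ℝ}

lemma not_notAC_of_eq_mul (hP : ∀ a, P a = Q a * r a) : ¬ NotAC P Q := by
  rintro ⟨a, h1, h2⟩
  exact h1 (by rw [hP, h2, zero_mul])

lemma secrecyDiv_top_le (hP : ∀ a, P a = Q a * r a) {δ : ℝ} (hδ : 0 ≤ δ)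
    (hQ : ∀ a, 0 ≤ Q a) (hr0 : ∀ a, 0 ≤ r a) (hr : ∀ a, r a ≤ 2 ^ δ) :
    secrecyDiv ⊤ P Q ≤ (δ : EReal) := by
  rw [secrecyDiv, if_pos rfl, renyiDiv, if_neg (not_notAC_of_eq_mul hP), if_pos rfl,
    EReal.coe_le_coe_iff]
  have h1 : ∀ a, P a / Q a ≤ 2 ^ δ := fun a => by
    rcases (hQ a).eq_or_lt with h | h
    · rw [← h, div_zero]; positivity
    · rw [hP, mul_div_cancel_left₀ _ h.ne']; exact hr a
  have h2 : ⨆ a, P a / Q a ≤ 2 ^ δ := Real.iSup_le h1 (by positivity)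
  have h3 : 0 ≤ ⨆ a, P a / Q a := Real.iSup_nonneg fun a => by
    rw [hP]; exact div_nonneg (mul_nonneg (hQ a) (hr0 a)) (hQ a)
  -- A vanishing supremum is harmless: `Real.logb 2 0 = 0 ≤ δ`.
  rcases h3.eq_or_lt with h0 | h0
  · rw [← h0, Real.logb_zero]; exact hδ
  · rwa [Real.logb_le_iff_le_rpow (by norm_num) h0]

lemma rpow_mul_rpow_one_sub {q t α : ℝ} (hq : 0 ≤ q) (ht : 0 ≤ t) (hα : α ≠ 0) :
    (q * t) ^ α * q ^ (1 - α) = q * t ^ α := by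
  rcases hq.eq_or_lt with h | h
  · rw [← h, zero_mul, zero_mul, Real.zero_rpow hα, zero_mul]
  · rw [Real.mul_rpow hq ht, mul_right_comm, ← Real.rpow_add h, add_sub_cancel, Real.rpow_one]

lemma secrecyDiv_le (hP : ∀ a, P a = Q a * r a) {α : ℝ≥0∞} (hα : 1 < α) (hα' : α ≠ ⊤) {δ : ℝ}
    (hQ : ∀ a, 0 ≤ Q a) (hr : ∀ a, 0 ≤ r a)
    (h : ∑ a, Q a * r a ^ α.toReal ≤ 1 + (α.toReal - 1) * δ) :
    secrecyDiv α P Q ≤ (δ : EReal) := by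
  have hα1 := one_lt_toReal hα hα'
  rw [secrecyDiv, if_neg hα', tsallisDiv, if_neg (not_notAC_of_eq_mul hP),
    EReal.coe_le_coe_iff]
  simp only [hP, rpow_mul_rpow_one_sub (hQ _) (hr _) (by linarith : α.toReal ≠ 0)]
  rw [one_div, inv_mul_le_iff₀ (by linarith)]
  linarith

/-- Divergences of probability mass functions are nonnegative. -/
lemma secrecyDiv_nonneg {α : ℝ≥0∞} (hα : 1 < α) (hP : P ∈ stdSimplex ℝ κ)
    (hQ : Q ∈ stdSimplex ℝ κ) : 0 ≤ secrecyDiv α P Q := by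
  by_cases hac : NotAC P Q
  · simp only [secrecyDiv, renyiDiv, tsallisDiv, if_pos hac]
    split_ifs <;> exact le_top
  have hPQ : ∀ a, P a = Q a * (P a / Q a) := fun a => by
    by_cases h : Q a = 0
    · rw [h, zero_mul]
      by_contra h'
      exact hac ⟨a, h', h⟩
    · rw [mul_div_cancel₀ _ h]
  have hr : ∀ a, 0 ≤ P a / Q a := fun a => div_nonneg (hP.1 a) (hQ.1 a)
  have hsum : ∑ a, Q a * (P a / Q a) = 1 := by
    rw [← hP.2]; exact Finset.sum_congr rfl fun a _ => (hPQ a).symm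
  by_cases hα' : α = ⊤
  · rw [secrecyDiv, if_pos hα', renyiDiv, if_neg hac, if_pos rfl, ← EReal.coe_zero,
      EReal.coe_le_coe_iff]
    refine Real.logb_nonneg (by norm_num) ?_
    calc (1 : ℝ) = ∑ a, Q a * (P a / Q a) := hsum.symm
      _ ≤ ∑ a, Q a * ⨆ a, P a / Q a := Finset.sum_le_sum fun a _ =>
          mul_le_mul_of_nonneg_left (le_ciSup (f := fun a => P a / Q a) (Set.finite_range _).bddAbove a) (hQ.1 a)
      _ = ⨆ a, P a / Q a := by rw [← Finset.sum_mul, hQ.2, one_mul]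
  · have hα1 := one_lt_toReal hα hα'
    rw [secrecyDiv, if_neg hα', tsallisDiv, if_neg hac, ← EReal.coe_zero,
      EReal.coe_le_coe_iff]
    have h1 : ∑ a, P a ^ α.toReal * Q a ^ (1 - α.toReal)
        = ∑ a, Q a * (P a / Q a) ^ α.toReal := Finset.sum_congr rfl fun a _ => by
      conv_lhs => rw [hPQ a]
      exact rpow_mul_rpow_one_sub (hQ.1 a) (hr a) (by linarith)
    have h2 := Real.rpow_arith_mean_le_arith_mean_rpow Finset.univ Q (fun a => P a / Q a)
      (fun a _ => hQ.1 a) hQ.2 (fun a _ => hr a) hα1.le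
    rw [hsum, Real.one_rpow] at h2
    rw [h1]
    exact mul_nonneg (by rw [one_div, inv_nonneg]; linarith) (by linarith)

end Divergence

/-! ### From good bins to codes -/

section Construction

variable {𝒳 𝒴 𝒵 : Type*} [Fintype 𝒳] [Fintype 𝒴] [Fintype 𝒵] {p : 𝒳 → ℝ}
  {W : 𝒳 → 𝒴 × 𝒵 → ℝ} {n M₁ M₂ : ℕ}

lemma sum_ite_iidLaw (p : 𝒳 → ℝ) (β : Binning 𝒳 n M₁ M₂) (b : Fin M₁ × Fin M₂) :
    ∑ x, (if β x = b then iidLaw p x else 0)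
      = binMass (iidLaw p) β b / Fintype.card (Fin M₁ × Fin M₂) := by
  have : Nonempty (Fin M₁ × Fin M₂) := ⟨b⟩
  rw [binMass, mul_div_cancel_left₀ _ (by positivity)]

lemma binEncoder_mem (hp : p ∈ stdSimplex ℝ 𝒳) {β : Binning 𝒳 n M₁ M₂} {f : Fin M₂} {m : Fin M₁}
    (hB : 0 < binMass (iidLaw p) β (m, f)) :
    binEncoder p β f m ∈ stdSimplex ℝ (Fin n → 𝒳) := by
  have : Nonempty (Fin M₁ × Fin M₂) := ⟨(m, f)⟩
  have hD : 0 < ∑ x, (if β x = (m, f) then iidLaw p x else 0) := by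
    rw [sum_ite_iidLaw]; positivity
  refine ⟨fun x => div_nonneg ?_ hD.le, ?_⟩
  · split_ifs
    · exact (iidLaw_mem hp n).1 x
    · exact le_rfl
  · simp only [binEncoder, ← Finset.sum_div]
    exact div_self hD.ne'

/-- The law of the output of the eavesdropper given the two bin indices. -/
lemma sum_binEncoder_mul_memoryless (hp : p ∈ stdSimplex ℝ 𝒳)
    (hW : ∀ x, W x ∈ stdSimplex ℝ (𝒴 × 𝒵)) (β : Binning 𝒳 n M₁ M₂) (f : Fin M₂) (m : Fin M₁)
    (z : Fin n → 𝒵) :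
    ∑ x, binEncoder p β f m x * memoryless (tapChannel W) x z
      = iidLaw (sndLaw (joint p (tapChannel W))) z *
        (binMass (fun x => condProb (blockLaw n (joint p (tapChannel W))) x z) β (m, f)
          / binMass (iidLaw p) β (m, f)) := by
  have hJ := (isJointLaw_joint hp (tapChannel_mem hW)).blockLaw n
  have : Nonempty (Fin M₁ × Fin M₂) := ⟨(m, f)⟩
  have hN : (Fintype.card (Fin M₁ × Fin M₂) : ℝ) ≠ 0 := by positivity
  simp only [binEncoder, sum_ite_iidLaw, div_mul_eq_mul_div, ← Finset.sum_div]
  have h : ∑ x, (if β x = (m, f) then iidLaw p x else 0) * memoryless (tapChannel W) x z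
      = sndLaw (blockLaw n (joint p (tapChannel W))) z * binMass (fun x =>
        condProb (blockLaw n (joint p (tapChannel W))) x z) β (m, f)
        / Fintype.card (Fin M₁ × Fin M₂) := by
    rw [binMass, mul_left_comm, mul_div_cancel_left₀ _ hN, Finset.mul_sum]
    refine Finset.sum_congr rfl fun x _ => ?_
    split_ifs
    · rw [hJ.sndLaw_mul_condProb, blockLaw_joint]
    · simp
  rw [h, div_div_div_cancel_right₀ hN, mul_div_assoc, sndLaw_blockLaw]

/-- The contribution of the second bin index `f` to the decoding error probability. -/
def rowError (p : 𝒳 → ℝ) (W : 𝒳 → 𝒴 × 𝒵 → ℝ) [Nonempty (Fin M₁)] (β : Binning 𝒳 n M₁ M₂)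
    (f : Fin M₂) : ℝ :=
  ∑ x, if (β x).2 = f then ∑ y, (if mapDecoder (blockLaw n (joint p (mainChannel W))) β f y
    = (β x).1 then 0 else blockLaw n (joint p (mainChannel W)) x y) else 0

lemma sum_rowError [Nonempty (Fin M₁)] (β : Binning 𝒳 n M₁ M₂) :
    ∑ f, rowError p W β f = decodingError (blockLaw n (joint p (mainChannel W))) β := by
  simp only [rowError, decodingError]
  rw [Finset.sum_comm]
  simp

lemma rowError_nonneg (hp : p ∈ stdSimplex ℝ 𝒳) (hW : ∀ x, W x ∈ stdSimplex ℝ (𝒴 × 𝒵))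
    [Nonempty (Fin M₁)] (β : Binning 𝒳 n M₁ M₂) (f : Fin M₂) : 0 ≤ rowError p W β f := by
  have hJ := (isJointLaw_joint hp (mainChannel_mem hW)).blockLaw n
  refine Finset.sum_nonneg fun x _ => ?_
  split_ifs
  · refine Finset.sum_nonneg fun y _ => ?_
    split_ifs
    · exact le_rfl
    · exact hJ.nonneg x y
  · exact le_rfl

/-- The messages are the `m` in `G`. Each of their bins has at least half the average mass, so
conditioning on the bin inflates probabilities by at most `2 M₁ M₂`; averaging over at least `M₁ /
2` messages leaves an error of at most `4 M₂` times the row error. -/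
lemma goodPair_of_goodBins (hp : p ∈ stdSimplex ℝ 𝒳) (hW : ∀ x, W x ∈ stdSimplex ℝ (𝒴 × 𝒵))
    {α : ℝ≥0∞} (hα : 1 < α) {R δ ε : ℝ} (hδ : 0 ≤ δ) (hε : ε ≤ 1 / 2) [Nonempty (Fin M₁)]
    (β : Binning 𝒳 n M₁ M₂) (f : Fin M₂) (G : Finset (Fin M₁))
    (hG : ∀ m ∈ G, GoodBin α (blockLaw n (joint p (tapChannel W))) ε δ β (m, f))
    (hGM : M₁ ≤ 2 * G.card) (hGR : (2 : ℝ) ^ ((n : ℝ) * R) ≤ G.card)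
    (herr : M₂ * rowError p W β f ≤ δ / 4) : GoodPair α p W R δ β f := by
  have hJ := (isJointLaw_joint hp (tapChannel_mem hW)).blockLaw n
  have hfst : fstLaw (blockLaw n (joint p (tapChannel W))) = iidLaw p := by
    ext x; rw [fstLaw_blockLaw, fstLaw_joint p (tapChannel_mem hW)]
  have hB : ∀ m ∈ G, 1 / 2 ≤ binMass (iidLaw p) β (m, f) := fun m hm => by
    have := (hG m hm).1
    rw [hfst] at this
    linarith
  have hM₁ : 0 < M₁ := Fin.pos_iff_nonempty.2 inferInstance
  have hK : 0 < G.card := by omega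
  have hK' : (0 : ℝ) < G.card := by exact_mod_cast hK
  have hM₂ : 0 < M₂ := Fin.pos_iff_nonempty.2 ⟨f⟩
  set dM := mapDecoder (blockLaw n (joint p (mainChannel W))) β f with hdM
  let c : WiretapCode 𝒳 𝒴 n :=
    { K := G.card
      enc := fun m => binEncoder p β f (G.equivFin.symm m)
      enc_mem := fun m => binEncoder_mem hp
        (by linarith [hB _ (G.equivFin.symm m).2])
      -- An estimate outside `G` is wrong for every message, so its replacement by index `0` cannot
      -- add errors.
      dec := fun y => if h : dM y ∈ G then G.equivFin ⟨dM y, h⟩ else ⟨0, hK⟩ }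
  have hdec : ∀ y m, dM y = (G.equivFin.symm m : Fin M₁) → c.dec y = m := by
    intro y m h
    have h' : dM y ∈ G := by rw [h]; exact (G.equivFin.symm m).2
    simp only [c, dif_pos h']
    rw [← G.equivFin.apply_symm_apply m]
    congr 1
    exact Subtype.ext h
  refine ⟨c, G.equivFin.symm.toEmbedding.trans (Function.Embedding.subtype _),
    fun m => rfl, hGM, hGR, ?_, ?_⟩
  · have hterm : ∀ m ∈ G, ∑ x, binEncoder p β f m x *
        ∑ y, (if dM y = m then 0 else memoryless (mainChannel W) x y)
        ≤ 2 * Fintype.card (Fin M₁ × Fin M₂) * ∑ x, if β x = (m, f) then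
          ∑ y, (if dM y = m then 0 else blockLaw n (joint p (mainChannel W)) x y) else 0 := by
      intro m hm
      have hBm := hB m hm
      rw [Finset.mul_sum]
      refine Finset.sum_le_sum fun x _ => ?_
      rw [binEncoder, sum_ite_iidLaw]
      split_ifs with h
      · have h0 : 0 ≤ ∑ y, (if dM y = m then 0 else blockLaw n (joint p (mainChannel W)) x y) :=
          Finset.sum_nonneg fun y _ => by
            split_ifs
            · exact le_rfl
            · exact ((isJointLaw_joint hp (mainChannel_mem hW)).blockLaw n).nonneg x y
        have h1 : iidLaw p x * ∑ y, (if dM y = m then 0 else memoryless (mainChannel W) x y)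
            = ∑ y, (if dM y = m then 0 else blockLaw n (joint p (mainChannel W)) x y) := by
          rw [Finset.mul_sum]
          refine Finset.sum_congr rfl fun y _ => ?_
          split_ifs
          · simp
          · rw [blockLaw_joint]
        have hN : (0 : ℝ) < Fintype.card (Fin M₁ × Fin M₂) := by
          have : Nonempty (Fin M₁ × Fin M₂) := ⟨(m, f)⟩
          positivity
        rw [div_mul_eq_mul_div, h1, div_div_eq_mul_div, div_le_iff₀ (by linarith)]
        have := mul_nonneg h0 hN.le
        nlinarith
      · simp
    have hsum : c.errorProb W ≤ (1 / (G.card : ℝ)) * ∑ m ∈ G, ∑ x, binEncoder p β f m x *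
        ∑ y, (if dM y = m then 0 else memoryless (mainChannel W) x y) := by
      refine mul_le_mul_of_nonneg_left ?_ (by positivity)
      rw [← Finset.sum_coe_sort G (fun m => ∑ x, binEncoder p β f m x *
        ∑ y, (if dM y = m then 0 else memoryless (mainChannel W) x y)),
        ← G.equivFin.symm.sum_comp]
      refine Finset.sum_le_sum fun m _ => Finset.sum_le_sum fun x _ =>
        mul_le_mul_of_nonneg_left (Finset.sum_le_sum fun y _ => ?_) ((c.enc_mem m).1 x)
      have h0 : 0 ≤ memoryless (mainChannel W) x y := (memoryless_mem (mainChannel_mem hW) x).1 y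
      split_ifs with h1 h2 h2
      · exact le_rfl
      · exact h0
      · exact absurd (hdec y m h2) h1
      · exact le_rfl
    -- Each sequence with second index `f` lies in exactly one of the bins `(m, f)`.
    have hrow : ∑ m : Fin M₁, ∑ x, (if β x = (m, f) then
          ∑ y, (if dM y = m then 0 else blockLaw n (joint p (mainChannel W)) x y) else 0)
        = rowError p W β f := by
      rw [Finset.sum_comm, rowError]
      refine Finset.sum_congr rfl fun x _ => ?_
      rw [← hdM]
      by_cases h : (β x).2 = f
      · rw [if_pos h, Finset.sum_eq_single (β x).1]
        · rw [if_pos (show β x = ((β x).1, f) from Prod.ext rfl h)]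
        · intro m _ hm
          rw [if_neg fun h' => hm (by rw [h'])]
        · simp
      · rw [if_neg h]
        exact Finset.sum_eq_zero fun m _ => if_neg fun h' => h (by rw [h'])
    have hle : ∑ m ∈ G, ∑ x, binEncoder p β f m x *
        ∑ y, (if dM y = m then 0 else memoryless (mainChannel W) x y)
        ≤ 2 * (M₁ * M₂) * rowError p W β f := by
      refine (Finset.sum_le_sum hterm).trans ?_
      rw [← Finset.mul_sum, ← hrow]
      have hc : (Fintype.card (Fin M₁ × Fin M₂) : ℝ) = M₁ * M₂ := by simp
      rw [hc]
      refine mul_le_mul_of_nonneg_left ?_ (by positivity)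
      refine Finset.sum_le_univ_sum_of_nonneg fun m => Finset.sum_nonneg fun x _ => ?_
      split_ifs
      · refine Finset.sum_nonneg fun y _ => ?_
        split_ifs
        · exact le_rfl
        · exact ((isJointLaw_joint hp (mainChannel_mem hW)).blockLaw n).nonneg x y
      · exact le_rfl
    refine hsum.trans ?_
    rw [one_div, inv_mul_le_iff₀ hK']
    refine hle.trans ?_
    have h1 : (M₁ : ℝ) ≤ 2 * G.card := by exact_mod_cast hGM
    have h2 : (0 : ℝ) ≤ M₁ := Nat.cast_nonneg _
    calc 2 * ((M₁ : ℝ) * M₂) * rowError p W β f = 2 * M₁ * (M₂ * rowError p W β f) := by ring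
      _ ≤ 2 * M₁ * (δ / 4) := by gcongr
      _ ≤ G.card * δ := by nlinarith
  -- The density of the actual law relative to the ideal one; the factor `1 / K` is common to both.
  · set r : Fin c.K × (Fin n → 𝒵) → ℝ := fun mz =>
      binMass (fun x => condProb (blockLaw n (joint p (tapChannel W))) x mz.2) β
        ((G.equivFin.symm mz.1 : Fin M₁), f)
        / binMass (iidLaw p) β ((G.equivFin.symm mz.1 : Fin M₁), f) with hr
    have hP : ∀ mz, c.leakLaw W mz = c.idealLaw p W mz * r mz := by
      intro mz
      rw [WiretapCode.leakLaw, WiretapCode.idealLaw, mul_assoc]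
      congr 1
      exact sum_binEncoder_mul_memoryless hp hW β f _ mz.2
    have hQ : ∀ mz, 0 ≤ c.idealLaw p W mz := fun mz =>
      mul_nonneg (by positivity) (by rw [← sndLaw_blockLaw]; exact hJ.sndLaw_nonneg _)
    have hB0 : ∀ m : Fin c.K, 0 < binMass (iidLaw p) β ((G.equivFin.symm m : Fin M₁), f) :=
      fun m => by linarith [hB _ (G.equivFin.symm m).2]
    have hr0 : ∀ mz, 0 ≤ r mz := fun mz =>
      div_nonneg (binMass_nonneg (fun x => hJ.condProb_nonneg _ _) _ _) (hB0 _).le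
    by_cases hα' : α = ⊤
    · subst hα'
      refine secrecyDiv_top_le hP hδ hQ hr0 fun mz => ?_
      rw [hr, div_le_iff₀ (hB0 _)]
      have := (hG _ (G.equivFin.symm mz.1).2).2
      rw [if_pos rfl, hfst] at this
      exact this mz.2
    · refine secrecyDiv_le hP hα hα' hQ hr0 ?_
      rw [Fintype.sum_prod_type]
      have hm : ∀ m : Fin c.K, ∑ z, c.idealLaw p W (m, z) * r (m, z) ^ α.toReal
          ≤ (1 / (c.K : ℝ)) * (1 + (α.toReal - 1) * δ) := by
        intro m
        have h1 := (hG _ (G.equivFin.symm m).2).2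
        rw [if_neg hα', hfst] at h1
        have h2 : ∑ z, c.idealLaw p W (m, z) * r (m, z) ^ α.toReal
            = (1 / (c.K : ℝ)) * (binMoment (blockLaw n (joint p (tapChannel W))) β
              ((G.equivFin.symm m : Fin M₁), f) α.toReal
              / binMass (iidLaw p) β ((G.equivFin.symm m : Fin M₁), f) ^ α.toReal) := by
          rw [binMoment, Finset.sum_div, Finset.mul_sum]
          refine Finset.sum_congr rfl fun z _ => ?_
          rw [WiretapCode.idealLaw, hr, Real.div_rpow
            (binMass_nonneg (fun x => hJ.condProb_nonneg _ _) _ _) (hB0 _).le, sndLaw_blockLaw]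
          ring
        rw [h2]
        refine mul_le_mul_of_nonneg_left ?_ (by positivity)
        rwa [div_le_iff₀ (Real.rpow_pos_of_pos (hB0 m) _)]
      refine (Finset.sum_le_sum fun m _ => hm m).trans (le_of_eq ?_)
      rw [Finset.sum_const, Finset.card_univ, Fintype.card_fin, nsmul_eq_mul, ← mul_assoc,
        mul_one_div_cancel, one_mul]
      exact hK'.ne'

open Classical in
-- A pair fails only if fewer than half of the bins in row `f` are good or the row error is large;
-- each alternative makes one term at least one. By `hM`, half of the bins are enough messages.
lemma ite_not_goodPair_le (hp : p ∈ stdSimplex ℝ 𝒳) (hW : ∀ x, W x ∈ stdSimplex ℝ (𝒴 × 𝒵))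
    {α : ℝ≥0∞} (hα : 1 < α) {R δ ε : ℝ} (hδ : 0 < δ) (hε : ε ≤ 1 / 2) [Nonempty (Fin M₁)]
    (hM : 2 * (2 : ℝ) ^ ((n : ℝ) * R) ≤ M₁) (β : Binning 𝒳 n M₁ M₂) (f : Fin M₂) :
    (if GoodPair α p W R δ β f then (0 : ℝ) else 1)
      ≤ 2 / M₁ * (∑ m, if GoodBin α (blockLaw n (joint p (tapChannel W))) ε δ β (m, f)
          then (0 : ℝ) else 1)
        + 4 / δ * (M₂ * rowError p W β f) := by
  have hM₁ : (0 : ℝ) < M₁ := by exact_mod_cast Fin.pos_iff_nonempty.2 inferInstance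
  set G := Finset.univ.filter fun m =>
    GoodBin α (blockLaw n (joint p (tapChannel W))) ε δ β (m, f) with hG
  have hbad : (∑ m, if GoodBin α (blockLaw n (joint p (tapChannel W))) ε δ β (m, f)
      then (0 : ℝ) else 1) = M₁ - G.card := by
    have : ∀ m, (if GoodBin α (blockLaw n (joint p (tapChannel W))) ε δ β (m, f)
      then (0 : ℝ) else 1) = 1 - if GoodBin α (blockLaw n (joint p (tapChannel W))) ε δ β (m, f)
      then (1 : ℝ) else 0 := fun m => by split_ifs <;> norm_num
    simp only [this]
    rw [Finset.sum_sub_distrib, Finset.sum_boole]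
    simp [hG]
  rw [hbad]
  have hGle : (G.card : ℝ) ≤ M₁ := by
    have := G.card_le_univ
    rw [Fintype.card_fin] at this
    exact_mod_cast this
  have hrow := mul_nonneg (Nat.cast_nonneg (α := ℝ) M₂) (rowError_nonneg hp hW β f)
  have h1 : 0 ≤ 2 / (M₁ : ℝ) * (M₁ - G.card) := mul_nonneg (by positivity) (by linarith)
  have h2 : 0 ≤ 4 / δ * (M₂ * rowError p W β f) := mul_nonneg (by positivity) hrow
  split_ifs with hgp
  · linarith
  by_cases hGM : (M₁ : ℝ) ≤ 2 * G.card
  · have : δ / 4 ≤ M₂ * rowError p W β f := by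
      by_contra! hlt
      exact hgp (goodPair_of_goodBins hp hW hα hδ.le hε β f G (fun m hm => by simpa [hG] using hm)
        (by exact_mod_cast hGM) (by linarith) hlt.le)
    have h3 : 1 ≤ 4 / δ * (M₂ * rowError p W β f) := by
      rw [div_mul_eq_mul_div, le_div_iff₀ hδ]; linarith
    linarith
  · push Not at hGM
    have h3 : 1 ≤ 2 / (M₁ : ℝ) * (M₁ - G.card) := by
      rw [div_mul_eq_mul_div, le_div_iff₀ hM₁]; linarith
    linarith

open Classical in
/-- For every binning, most second bin indices are good if most bins are good and the decoding
error is small. -/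
lemma sum_goodPair_ge (hp : p ∈ stdSimplex ℝ 𝒳) (hW : ∀ x, W x ∈ stdSimplex ℝ (𝒴 × 𝒵))
    {α : ℝ≥0∞} (hα : 1 < α) {R δ ε : ℝ} (hδ : 0 < δ) (hε0 : 0 ≤ ε) (hε : ε ≤ 1 / 2)
    [Nonempty (Fin M₁)] [Nonempty (Fin M₂)]
    (hM : 2 * (2 : ℝ) ^ ((n : ℝ) * R) ≤ M₁) (β : Binning 𝒳 n M₁ M₂) :
    1 - ε - 3 * (𝔼 b, if GoodBin α (blockLaw n (joint p (tapChannel W))) ε δ β b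
        then (0 : ℝ) else 1)
      - 4 / δ * decodingError (blockLaw n (joint p (mainChannel W))) β
      ≤ ∑ x, iidLaw p x * if GoodPair α p W R δ β (β x).2 then (1 : ℝ) else 0 := by
  have hM₁ : (0 : ℝ) < M₁ := by exact_mod_cast Fin.pos_iff_nonempty.2 inferInstance
  have hM₂ : (0 : ℝ) < M₂ := by exact_mod_cast Fin.pos_iff_nonempty.2 inferInstance
  have hN : (Fintype.card (Fin M₁ × Fin M₂) : ℝ) = M₁ * M₂ := by simp
  have hfst : fstLaw (blockLaw n (joint p (tapChannel W))) = iidLaw p := by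
    ext x; rw [fstLaw_blockLaw, fstLaw_joint p (tapChannel_mem hW)]
  set g : Fin M₁ × Fin M₂ → ℝ := fun b =>
    if GoodBin α (blockLaw n (joint p (tapChannel W))) ε δ β b then (0 : ℝ) else 1 with hg
  set h : Fin M₂ → ℝ := fun f => if GoodPair α p W R δ β f then (0 : ℝ) else 1 with hh
  set D := decodingError (blockLaw n (joint p (mainChannel W))) β with hD
  -- The bin of the source sequence has law `binMass / (M₁ M₂)`, so the probability of a good `f` is
  -- a uniform average over bins weighted by their masses.
  have hlhs : ∑ x, iidLaw p x * (if GoodPair α p W R δ β (β x).2 then (1 : ℝ) else 0)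
      = 𝔼 b, binMass (iidLaw p) β b * (1 - h b.2) := by
    rw [Fintype.expect_eq_sum_div_card, Finset.sum_div]
    have : ∀ b, binMass (iidLaw p) β b * (1 - h b.2) / (Fintype.card (Fin M₁ × Fin M₂) : ℝ)
        = ∑ x, if β x = b then iidLaw p x * (1 - h b.2) else 0 := by
      intro b
      rw [mul_div_right_comm, ← sum_ite_iidLaw, Finset.sum_mul]
      exact Finset.sum_congr rfl fun x _ => by split_ifs <;> simp
    simp only [this]
    rw [Finset.sum_comm]
    refine Finset.sum_congr rfl fun x _ => ?_
    rw [Finset.sum_ite_eq, if_pos (Finset.mem_univ _), hh]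
    dsimp only
    split_ifs <;> simp
  -- A good bin carries mass at least `1 - ε`; if the bin or the pair is bad, the left side is
  -- nonpositive. Bad bins are counted once here and twice in `hexp`, whence the factor `3`.
  have hpt : ∀ b, (1 - ε) - h b.2 - g b ≤ binMass (iidLaw p) β b * (1 - h b.2) := by
    intro b
    have hB0 : 0 ≤ binMass (iidLaw p) β b := binMass_nonneg (iidLaw_mem hp n).1 β b
    by_cases h1 : GoodPair α p W R δ β b.2 <;>
      by_cases h2 : GoodBin α (blockLaw n (joint p (tapChannel W))) ε δ β b
    · have := h2.1
      rw [hfst] at this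
      simp only [hh, hg, if_pos h1, if_pos h2]; linarith
    · simp only [hh, hg, if_pos h1, if_neg h2]; linarith
    · simp only [hh, hg, if_neg h1, if_pos h2]; linarith
    · simp only [hh, hg, if_neg h1, if_neg h2]; linarith
  have hexp : 𝔼 b : Fin M₁ × Fin M₂, h b.2 ≤ 2 * (𝔼 b, g b) + 4 / δ * D := by
    rw [Fintype.expect_eq_sum_div_card, Fintype.expect_eq_sum_div_card, hN, hD,
      ← sum_rowError, Fintype.sum_prod_type_right, Fintype.sum_prod_type_right]
    simp only [Finset.sum_const, Finset.card_univ, Fintype.card_fin, nsmul_eq_mul]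
    rw [← Finset.mul_sum, mul_div_mul_left _ _ hM₁.ne', div_le_iff₀ hM₂]
    refine (Finset.sum_le_sum fun f _ => ite_not_goodPair_le hp hW hα hδ hε hM β f).trans
      (le_of_eq ?_)
    rw [Finset.sum_add_distrib, ← Finset.mul_sum, ← Finset.mul_sum, ← Finset.mul_sum]
    simp only [hg]
    field_simp
  rw [hlhs]
  have h3 := Finset.expect_le_expect (s := Finset.univ) fun b _ => hpt b
  rw [Finset.expect_sub_distrib, Finset.expect_sub_distrib, Fintype.expect_const] at h3
  linarith

open Classical in
lemma goodProb_eq_expect (α : ℝ≥0∞) (p : 𝒳 → ℝ) (W : 𝒳 → 𝒴 × 𝒵 → ℝ) (R δ : ℝ)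
    (n M₁ M₂ : ℕ) : goodProb α p W R δ n M₁ M₂
      = 𝔼 β : Binning 𝒳 n M₁ M₂, ∑ x, iidLaw p x *
          if GoodPair α p W R δ β (β x).2 then (1 : ℝ) else 0 := by
  rw [Fintype.expect_eq_sum_div_card, goodProb]

lemma goodProb_le_one (hp : p ∈ stdSimplex ℝ 𝒳) (α : ℝ≥0∞) (R δ : ℝ)
    (n M₁ M₂ : ℕ) : goodProb α p W R δ n M₁ M₂ ≤ 1 := by
  rw [goodProb]
  refine div_le_one_of_le₀ ?_ (Nat.cast_nonneg _)
  refine (Finset.sum_le_card_nsmul _ _ 1 fun β _ => ?_).trans (by simp)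
  refine (Finset.sum_le_sum fun x _ =>
    mul_le_of_le_one_right ((iidLaw_mem hp n).1 x) ?_).trans_eq (iidLaw_mem hp n).2
  split_ifs <;> norm_num

open Classical in
lemma goodProb_ge (hp : p ∈ stdSimplex ℝ 𝒳) (hW : ∀ x, W x ∈ stdSimplex ℝ (𝒴 × 𝒵))
    {α : ℝ≥0∞} (hα : 1 < α) {R δ ε τ s : ℝ} (hδ : 0 < δ) (hε0 : 0 ≤ ε) (hε : ε ≤ 1 / 2)
    (hM₁ : 0 < M₁) (hM₂ : 0 < M₂) (hM : 2 * (2 : ℝ) ^ ((n : ℝ) * R) ≤ M₁)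
    (hτ : ∀ b, 𝔼 β : Binning 𝒳 n M₁ M₂,
      (if ¬ GoodBin α (blockLaw n (joint p (tapChannel W))) ε δ β b then (1 : ℝ) else 0) ≤ τ)
    (hs : 0 ≤ s) (hs1 : s ≤ 1) :
    1 - ε - 3 * τ - 4 / δ * condMoment M₂ (blockLaw n (joint p (mainChannel W))) (-s)
      ≤ goodProb α p W R δ n M₁ M₂ := by
  have i1 : Nonempty (Fin M₁) := ⟨⟨0, hM₁⟩⟩
  have i2 : Nonempty (Fin M₂) := ⟨⟨0, hM₂⟩⟩
  rw [goodProb_eq_expect]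
  refine le_trans ?_ (Finset.expect_le_expect fun β _ =>
    sum_goodPair_ge hp hW hα hδ hε0 hε hM β)
  rw [Finset.expect_sub_distrib, Finset.expect_sub_distrib, Fintype.expect_const,
    ← Finset.mul_expect, ← Finset.mul_expect]
  have h1 := expect_decodingError_le (I := Fin M₁) (L := Fin M₂)
    ((isJointLaw_joint hp (mainChannel_mem hW)).blockLaw n) hs hs1
  rw [Fintype.card_fin] at h1
  have h2 : 𝔼 β : Binning 𝒳 n M₁ M₂, 𝔼 b,
      (if GoodBin α (blockLaw n (joint p (tapChannel W))) ε δ β b then (0 : ℝ) else 1) ≤ τ := by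
    rw [Finset.expect_comm]
    refine Finset.expect_le Finset.univ_nonempty fun b _ => ?_
    simpa only [ite_not] using hτ b
  have h3 := mul_le_mul_of_nonneg_left h1 (show 0 ≤ 4 / δ by positivity)
  linarith

end Construction

/-! ### Exponential decay below and above the entropies -/

section Rates

variable {𝒜 ℬ : Type*} [Fintype 𝒜] [Fintype ℬ] {J : 𝒜 → ℬ → ℝ}

lemma IsJointLaw.le_sndLaw (hJ : IsJointLaw J) (a : 𝒜) (b : ℬ) : J a b ≤ sndLaw J b :=
  Finset.single_le_sum (fun a _ => hJ.nonneg a b) (Finset.mem_univ a)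

lemma IsJointLaw.condProb_pos (hJ : IsJointLaw J) {a : 𝒜} {b : ℬ} (h : J a b ≠ 0) :
    0 < condProb J a b :=
  have h' := (hJ.nonneg a b).lt_of_ne' h
  div_pos h' (h'.trans_le (hJ.le_sndLaw a b))

lemma IsJointLaw.condProb_le_one (hJ : IsJointLaw J) (a : 𝒜) (b : ℬ) : condProb J a b ≤ 1 :=
  div_le_one_of_le₀ (hJ.le_sndLaw a b) (hJ.sndLaw_nonneg b)

lemma IsJointLaw.exists_ne_zero (hJ : IsJointLaw J) : ∃ a b, J a b ≠ 0 := by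
  by_contra! h
  have := hJ.sum_eq_one
  simp [h] at this

lemma condEntropy_nonneg (hJ : IsJointLaw J) : 0 ≤ condEntropy J := by
  rw [condEntropy, neg_nonneg]
  refine Finset.sum_nonpos fun a _ => Finset.sum_nonpos fun b _ =>
    mul_nonpos_of_nonneg_of_nonpos (hJ.nonneg a b) ?_
  exact Real.logb_nonpos (by norm_num) (hJ.condProb_nonneg a b) (hJ.condProb_le_one a b)

/-- Above the conditional entropy, the moments of negative order decay. -/
lemma exists_condMoment_lt_one (hJ : IsJointLaw J) {R : ℝ} (hR : condEntropy J < R) :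
    ∃ s : ℝ, 0 < s ∧ s ≤ 1 ∧ condMoment (2 ^ R) J (-s) < 1 := by
  have h2 : (0 : ℝ) < 2 ^ R := by positivity
  set L : 𝒜 → ℬ → ℝ := fun a b => Real.log (2 ^ R * condProb J a b) with hL
  -- Here `φ 0 = 1` and the derivative at zero is `log 2 * (H - R) < 0`, with `H` the conditional
  -- entropy, so `φ` falls below one for small positive `s`.
  set φ : ℝ → ℝ := fun s => ∑ a, ∑ b, J a b * Real.exp (-s * L a b) with hφ
  have hφeq : ∀ s, condMoment (2 ^ R) J (-s) = φ s := fun s => by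
    refine Finset.sum_congr rfl fun a _ => Finset.sum_congr rfl fun b _ => ?_
    by_cases h : J a b = 0
    · rw [h, zero_mul, zero_mul]
    · rw [Real.rpow_def_of_pos (mul_pos h2 (hJ.condProb_pos h)), mul_comm (-s)]
  have hφ0 : φ 0 = 1 := by simp [hφ, hJ.sum_eq_one]
  have hderiv : HasDerivAt φ (∑ a, ∑ b, J a b * (-L a b)) 0 := by
    refine HasDerivAt.fun_sum fun a _ => HasDerivAt.fun_sum fun b _ => ?_
    have h1 : HasDerivAt (fun s : ℝ => -s * L a b) (-L a b) 0 := by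
      simpa using (hasDerivAt_id (0 : ℝ)).neg.mul_const (L a b)
    simpa using h1.exp.const_mul (J a b)
  have hneg : ∑ a, ∑ b, J a b * (-L a b) < 0 := by
    have h1 : ∀ a b, J a b * (-L a b) = Real.log 2 *
        (-(J a b * Real.logb 2 (condProb J a b)) - J a b * R) := by
      intro a b
      by_cases h : J a b = 0
      · simp [h]
      · rw [hL]
        dsimp only
        rw [Real.log_mul h2.ne' (hJ.condProb_pos h).ne', Real.log_rpow (by norm_num), Real.logb]
        field_simp
        ring
    simp only [h1, ← Finset.mul_sum, Finset.sum_sub_distrib, Finset.sum_neg_distrib,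
      ← Finset.sum_mul, hJ.sum_eq_one, one_mul]
    exact mul_neg_of_pos_of_neg (Real.log_pos (by norm_num)) (by rw [condEntropy] at hR; linarith)
  have hev : ∀ᶠ s in 𝓝[>] (0 : ℝ), slope φ 0 s < 0 :=
    ((hasDerivAt_iff_tendsto_slope.1 hderiv).mono_left
      (nhdsWithin_mono _ fun s hs => ne_of_gt hs)).eventually_lt_const hneg
  have hev1 : ∀ᶠ s in 𝓝[>] (0 : ℝ), s < 1 :=
    nhdsWithin_le_nhds (eventually_lt_nhds one_pos)
  obtain ⟨s, ⟨hs, hs1⟩, hs0⟩ := ((hev.and hev1).and self_mem_nhdsWithin).exists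
  have hs0 : 0 < s := hs0
  refine ⟨s, hs0, hs1.le, ?_⟩
  rw [hφeq]
  rw [slope_def_field, sub_zero, div_neg_iff] at hs
  rcases hs with h | h
  · linarith [h.2]
  · linarith [h.1]

lemma two_rpow_div_two_le_floor {n : ℕ} {R : ℝ} (hR : 0 ≤ R) :
    (2 : ℝ) ^ ((n : ℝ) * R) / 2 ≤ ⌊(2 : ℝ) ^ ((n : ℝ) * R)⌋₊ := by
  have h1 : (1 : ℝ) ≤ 2 ^ ((n : ℝ) * R) := Real.one_le_rpow (by norm_num) (by positivity)
  have h2 : (1 : ℝ) ≤ ⌊(2 : ℝ) ^ ((n : ℝ) * R)⌋₊ := by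
    exact_mod_cast (Nat.one_le_floor_iff _).2 h1
  have h3 := Nat.lt_floor_add_one ((2 : ℝ) ^ ((n : ℝ) * R))
  linarith

lemma two_rpow_natCast_mul (n : ℕ) (R : ℝ) : (2 : ℝ) ^ ((n : ℝ) * R) = ((2 : ℝ) ^ R) ^ n := by
  rw [mul_comm, Real.rpow_mul (by norm_num), Real.rpow_natCast]

lemma tendsto_condMoment_neg (hJ : IsJointLaw J) {R : ℝ} (hR : condEntropy J < R) :
    ∃ s : ℝ, 0 < s ∧ s ≤ 1 ∧ Tendsto (fun n : ℕ =>
      condMoment ⌊(2 : ℝ) ^ ((n : ℝ) * R)⌋₊ (blockLaw n J) (-s)) atTop (𝓝 0) := by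
  obtain ⟨s, hs, hs1, hlt⟩ := exists_condMoment_lt_one hJ hR
  have hR0 : 0 ≤ R := (condEntropy_nonneg hJ).trans hR.le
  refine ⟨s, hs, hs1, ?_⟩
  -- For a negative exponent the floor must be bounded from below; losing a factor of two in it
  -- costs `2 ^ s`.
  have hlim : Tendsto (fun n : ℕ => (2 : ℝ) ^ s * condMoment (2 ^ R) J (-s) ^ n) atTop (𝓝 0) := by
    simpa using (tendsto_pow_atTop_nhds_zero_of_lt_one
      (condMoment_nonneg hJ (by positivity) _) hlt).const_mul ((2 : ℝ) ^ s)
  refine squeeze_zero (fun n => condMoment_nonneg (hJ.blockLaw n) (Nat.cast_nonneg _) _)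
    (fun n => ?_) hlim
  have h1 : condMoment (2 ^ R) J (-s) = (2 ^ R) ^ (-s) * condMoment 1 J (-s) := by
    simp only [condMoment, one_mul, Finset.mul_sum]
    refine Finset.sum_congr rfl fun a _ => Finset.sum_congr rfl fun b _ => ?_
    rw [Real.mul_rpow (by positivity) (hJ.condProb_nonneg a b)]
    ring
  rw [condMoment_blockLaw hJ n (Nat.cast_nonneg _), h1, mul_pow, ← mul_assoc]
  refine mul_le_mul_of_nonneg_right ?_ (pow_nonneg (condMoment_nonneg hJ zero_le_one _) _)
  refine (Real.rpow_le_rpow_of_nonpos (by positivity) (two_rpow_div_two_le_floor hR0)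
    (by linarith)).trans (le_of_eq ?_)
  rw [Real.div_rpow (by positivity) (by norm_num), Real.rpow_neg zero_le_two, div_inv_eq_mul,
    mul_comm, two_rpow_natCast_mul, ← Real.rpow_pow_comm (by positivity)]

lemma sum_sndLaw_mul_sum_condProb_rpow (hJ : IsJointLaw J) {α : ℝ} (hα : α ≠ 0) :
    ∑ b, sndLaw J b * ∑ a, condProb J a b ^ α = condMoment 1 J (α - 1) := by
  simp only [condMoment, one_mul, Finset.mul_sum]
  rw [Finset.sum_comm]
  refine Finset.sum_congr rfl fun a _ => Finset.sum_congr rfl fun b _ => ?_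
  rw [← hJ.sndLaw_mul_condProb a b, mul_assoc, mul_comm (condProb J a b),
    ← Real.rpow_add_one' (hJ.condProb_nonneg a b) (by simpa using hα), sub_add_cancel]

/-- Below the conditional Rényi entropy, the moments of the bin masses decay. -/
lemma tendsto_condMoment_of_lt (hJ : IsJointLaw J) {α : ℝ≥0∞} (hα : 1 < α) (hα' : α ≠ ⊤)
    {R : ℝ} (hR : R < condRenyiEntropy α J) {N : ℕ → ℝ} (hN0 : ∀ n, 0 ≤ N n)
    (hN : ∀ n : ℕ, N n ≤ 2 ^ ((n : ℝ) * R)) :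
    Tendsto (fun n : ℕ => condMoment (N n) (blockLaw n J) (α.toReal - 1)) atTop (𝓝 0) := by
  have hα1 := one_lt_toReal hα hα'
  set t := α.toReal - 1 with ht
  have ht0 : 0 < t := by linarith
  have hc0 := condMoment_nonneg hJ zero_le_one t
  have hlt : (2 ^ R) ^ t * condMoment 1 J t < 1 := by
    rcases hc0.eq_or_lt with h | h
    · rw [← h, mul_zero]; exact one_pos
    · rw [condRenyiEntropy, if_neg hα', sum_sndLaw_mul_sum_condProb_rpow hJ (by linarith), ← ht,
        show 1 - α.toReal = -t by rw [ht]; ring, one_div, inv_neg, neg_mul, lt_neg,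
        inv_mul_lt_iff₀ ht0, Real.logb_lt_iff_lt_rpow (by norm_num) h] at hR
      calc (2 ^ R) ^ t * condMoment 1 J t < (2 ^ R) ^ t * 2 ^ (t * -R) := by gcongr
        _ = 1 := by
          rw [← Real.rpow_mul (by norm_num), ← Real.rpow_add (by norm_num),
            show R * t + t * -R = 0 by ring, Real.rpow_zero]
  refine squeeze_zero (fun n => condMoment_nonneg (hJ.blockLaw n) (hN0 n) _) (fun n => ?_)
    (tendsto_pow_atTop_nhds_zero_of_lt_one (by positivity) hlt)
  rw [condMoment_blockLaw hJ n (hN0 n), mul_pow]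
  refine mul_le_mul_of_nonneg_right ?_ (pow_nonneg hc0 _)
  refine (Real.rpow_le_rpow (hN0 n) (hN n) ht0.le).trans (le_of_eq ?_)
  rw [two_rpow_natCast_mul, ← Real.rpow_pow_comm (by positivity)]

lemma condProb_le_iSup (J : 𝒜 → ℬ → ℝ) (a : 𝒜) (b : ℬ) :
    condProb J a b ≤ ⨆ ab : 𝒜 × ℬ, condProb J ab.1 ab.2 :=
  le_ciSup (f := fun ab : 𝒜 × ℬ => condProb J ab.1 ab.2) (Set.finite_range _).bddAbove (a, b)

lemma iSup_condProb_pos (hJ : IsJointLaw J) : 0 < ⨆ ab : 𝒜 × ℬ, condProb J ab.1 ab.2 := by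
  obtain ⟨a, b, h⟩ := hJ.exists_ne_zero
  exact (hJ.condProb_pos h).trans_le (condProb_le_iSup J a b)

lemma exists_condProb_blockLaw_le (hJ : IsJointLaw J)
    {R : ℝ} (hR : R < condRenyiEntropy ⊤ J) {N : ℕ → ℝ} (hN : ∀ n : ℕ, N n ≤ 2 ^ ((n : ℝ) * R)) :
    ∃ ρ : ℝ, 0 < ρ ∧ ρ < 1 ∧ ∀ n a b, N n * condProb (blockLaw n J) a b ≤ ρ ^ n := by
  set c := ⨆ ab : 𝒜 × ℬ, condProb J ab.1 ab.2 with hc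
  have hc0 : 0 < c := iSup_condProb_pos hJ
  refine ⟨2 ^ R * c, by positivity, ?_, fun n a b => ?_⟩
  · rw [condRenyiEntropy, if_pos rfl, ← hc,
      Real.lt_logb_iff_rpow_lt (by norm_num) (by positivity), lt_div_iff₀ hc0] at hR
    exact hR
  · rw [mul_pow, ← two_rpow_natCast_mul, condProb_blockLaw]
    refine mul_le_mul (hN n) ?_ (Finset.prod_nonneg fun i _ => hJ.condProb_nonneg _ _)
      (by positivity)
    refine (Finset.prod_le_prod (fun i _ => hJ.condProb_nonneg _ _)
      fun i _ => condProb_le_iSup J _ _).trans (by simp [hc])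

/-- The exponential beats every power: `exp (-u) ≤ k! / u ^ k`, with `k` so large that `K * ρ ^ k <
1`. This pays for the union bound over the `|𝒵| ^ n` outputs. -/
lemma tendsto_pow_mul_exp_neg_div_pow {K ρ θ : ℝ} (hK : 0 ≤ K) (hρ : 0 < ρ) (hρ1 : ρ < 1)
    (hθ : 0 < θ) : Tendsto (fun n : ℕ => K ^ n * Real.exp (-(θ / ρ ^ n))) atTop (𝓝 0) := by
  obtain ⟨k, hk⟩ : ∃ k : ℕ, K * ρ ^ k < 1 := by
    have : Tendsto (fun k : ℕ => K * ρ ^ k) atTop (𝓝 0) := by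
      simpa using (tendsto_pow_atTop_nhds_zero_of_lt_one hρ.le hρ1).const_mul K
    exact (this.eventually_lt_const one_pos).exists
  have hlim : Tendsto (fun n : ℕ => (k.factorial / θ ^ k : ℝ) * (K * ρ ^ k) ^ n) atTop (𝓝 0) := by
    simpa using (tendsto_pow_atTop_nhds_zero_of_lt_one (by positivity) hk).const_mul
      (k.factorial / θ ^ k : ℝ)
  refine squeeze_zero (fun n => by positivity) (fun n => ?_) hlim
  have h1 := Real.pow_div_factorial_le_exp (θ / ρ ^ n) (by positivity) k
  have h2 : Real.exp (-(θ / ρ ^ n)) ≤ k.factorial / (θ / ρ ^ n) ^ k := by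
    rw [Real.exp_neg, inv_le_comm₀ (Real.exp_pos _) (by positivity), inv_div]
    exact h1
  refine (mul_le_mul_of_nonneg_left h2 (by positivity)).trans (le_of_eq ?_)
  rw [div_pow, mul_pow, ← pow_mul, ← pow_mul, mul_comm n k]
  field_simp

end Rates

/-! ### Choice of rates and passage to a sequence of codes -/

section Achievability

variable {𝒳 𝒴 𝒵 : Type*} [Fintype 𝒳] [Fintype 𝒴] [Fintype 𝒵]

open Classical in
lemma eventually_expect_not_goodBin_le {J : 𝒳 → 𝒵 → ℝ} (hJ : IsJointLaw J) {α : ℝ≥0∞}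
    (hα : 1 < α) {R : ℝ} (hR : R < condRenyiEntropy α J) {ε δ τ : ℝ} (hε : 0 < ε) (hε1 : ε < 1)
    (hδ : 0 < δ) (hτ : 0 < τ) {M₁ M₂ : ℕ → ℕ}
    (hM : ∀ n : ℕ, (M₁ n * M₂ n : ℝ) ≤ 2 ^ ((n : ℝ) * R)) :
    ∀ᶠ n in atTop, ∀ b, 𝔼 β : Binning 𝒳 n (M₁ n) (M₂ n),
      (if ¬ GoodBin α (blockLaw n J) ε δ β b then (1 : ℝ) else 0) ≤ τ := by
  have hcard : ∀ n, (Fintype.card (Fin (M₁ n) × Fin (M₂ n)) : ℝ) = M₁ n * M₂ n := by simp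
  by_cases hα' : α = ⊤
  · subst hα'
    obtain ⟨κ, hκ, θ, hθ, H⟩ := exists_forall_expect_not_goodBin_top_le hε hε1 hδ hτ
    obtain ⟨ρ, hρ, hρ1, hle⟩ := exists_condProb_blockLaw_le hJ hR hM
    have h1 := (tendsto_pow_atTop_nhds_zero_of_lt_one hρ.le hρ1).eventually_le_const hκ
    have h2 := (tendsto_pow_mul_exp_neg_div_pow (Nat.cast_nonneg (Fintype.card 𝒵)) hρ hρ1
      hθ).eventually_le_const hκ
    filter_upwards [h1, h2] with n h1 h2 b
    have : Nonempty (Fin (M₁ n) × Fin (M₂ n)) := ⟨b⟩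
    refine H (Fin n → 𝒳) (Fin n → 𝒵) (Fin (M₁ n) × Fin (M₂ n)) (blockLaw n J) (hJ.blockLaw n)
      (ρ ^ n) (by positivity) h1 ?_ (fun x z => ?_) b
    · simpa using h2
    · rw [hcard]; exact hle n x z
  · obtain ⟨κ, hκ, H⟩ := exists_forall_expect_not_goodBin_le hα hα' hε hε1 hδ hτ
    filter_upwards [(tendsto_condMoment_of_lt hJ hα hα' hR (fun n => by positivity)
      hM).eventually_le_const hκ] with n hn b
    have : Nonempty (Fin (M₁ n) × Fin (M₂ n)) := ⟨b⟩
    refine H (Fin n → 𝒳) (Fin n → 𝒵) (Fin (M₁ n) × Fin (M₂ n)) (blockLaw n J) (hJ.blockLaw n)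
      ?_ b
    rw [hcard]; exact hn

lemma eventually_two_mul_two_rpow_le_floor {R R₁ : ℝ} (hR : 0 ≤ R) (hR₁ : R < R₁) :
    ∀ᶠ n : ℕ in atTop, 2 * (2 : ℝ) ^ ((n : ℝ) * R) ≤ ⌊(2 : ℝ) ^ ((n : ℝ) * R₁)⌋₊ := by
  have h1 : (1 : ℝ) < 2 ^ (R₁ - R) := Real.one_lt_rpow (by norm_num) (by linarith)
  -- A factor `3` leaves `2` after rounding down, since `3 v - 1 ≥ 2 v` for `v ≥ 1`.
  filter_upwards [(tendsto_pow_atTop_atTop_of_one_lt h1).eventually_ge_atTop 3] with n hn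
  rw [← two_rpow_natCast_mul] at hn
  have h2 : (2 : ℝ) ^ ((n : ℝ) * R₁) = 2 ^ ((n : ℝ) * (R₁ - R)) * 2 ^ ((n : ℝ) * R) := by
    rw [← Real.rpow_add (by norm_num)]; ring_nf
  have h3 : (1 : ℝ) ≤ 2 ^ ((n : ℝ) * R) := Real.one_le_rpow (by norm_num) (by positivity)
  have h4 := Nat.lt_floor_add_one ((2 : ℝ) ^ ((n : ℝ) * R₁))
  nlinarith

variable {p : 𝒳 → ℝ} {W : 𝒳 → 𝒴 × 𝒵 → ℝ}

lemma achievedByIIDBinning (hp : p ∈ stdSimplex ℝ 𝒳) (hW : ∀ x, W x ∈ stdSimplex ℝ (𝒴 × 𝒵))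
    {α : ℝ≥0∞} (hα : 1 < α) {R : ℝ} (hR : 0 ≤ R)
    (hlt : R < condRenyiEntropy α (joint p (tapChannel W))
      - condEntropy (joint p (mainChannel W))) : AchievedByIIDBinning α p W R := by
  have hJT := isJointLaw_joint hp (tapChannel_mem hW)
  have hJM := isJointLaw_joint hp (mainChannel_mem hW)
  set H := condEntropy (joint p (mainChannel W)) with hH
  have hH0 : 0 ≤ H := condEntropy_nonneg hJM
  -- A third of the gap: with binning rates `R + g` and `H + g`, the total rate stays `g` below the
  -- Rényi entropy.
  set g := (condRenyiEntropy α (joint p (tapChannel W)) - H - R) / 3 with hg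
  have hg0 : 0 < g := by rw [hg]; linarith
  refine ⟨R + g, H + g, by linarith, by linarith, fun δ hδ => ?_⟩
  obtain ⟨s, hs, hs1, herr⟩ := tendsto_condMoment_neg hJM (show H < H + g by linarith)
  refine tendsto_order.2 ⟨fun a ha => ?_, fun a ha =>
    Eventually.of_forall fun n => (goodProb_le_one hp α R δ n _ _).trans_lt ha⟩
  -- The losses in `goodProb_ge` total at most `5 e`, and `1 - 5 e > a`.
  set e := min ((1 - a) / 6) (1 / 2) with he
  have he0 : 0 < e := lt_min (by linarith) (by norm_num)
  have he1 : e ≤ 1 / 2 := min_le_right _ _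
  have hea : e ≤ (1 - a) / 6 := min_le_left _ _
  have herr' := herr.const_mul (4 / δ)
  rw [mul_zero] at herr'
  have hMM : ∀ n : ℕ, (⌊(2 : ℝ) ^ ((n : ℝ) * (R + g))⌋₊ * ⌊(2 : ℝ) ^ ((n : ℝ) * (H + g))⌋₊ : ℝ)
      ≤ 2 ^ ((n : ℝ) * ((R + g) + (H + g))) := fun n => by
    rw [mul_add (n : ℝ) (R + g) (H + g), Real.rpow_add (by norm_num)]
    gcongr <;> exact Nat.floor_le (by positivity)
  filter_upwards [eventually_expect_not_goodBin_le hJT hα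
      (R := (R + g) + (H + g)) (by rw [hg]; linarith)
      he0 (by linarith) hδ he0
      (M₁ := fun n => ⌊(2 : ℝ) ^ ((n : ℝ) * (R + g))⌋₊)
      (M₂ := fun n => ⌊(2 : ℝ) ^ ((n : ℝ) * (H + g))⌋₊) hMM,
    eventually_two_mul_two_rpow_le_floor hR (show R < R + g by linarith),
    herr'.eventually_le_const he0] with n h1 h2 h3
  have hfl : ∀ r : ℝ, 0 ≤ r → 0 < ⌊(2 : ℝ) ^ ((n : ℝ) * r)⌋₊ := fun r hr =>
    Nat.floor_pos.2 (Real.one_le_rpow (by norm_num) (by positivity))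
  have := goodProb_ge hp hW hα hδ he0.le he1 (hfl (R + g) (by linarith)) (hfl (H + g) (by linarith)) h2 h1
    hs.le hs1
  linarith

lemma exists_goodPair_of_goodProb_pos {α : ℝ≥0∞} {R δ : ℝ} {n M₁ M₂ : ℕ}
    (h : 0 < goodProb α p W R δ n M₁ M₂) :
    ∃ (β : Binning 𝒳 n M₁ M₂) (f : Fin M₂), GoodPair α p W R δ β f := by
  by_contra! hno
  rw [goodProb] at h
  simp [hno] at h

lemma errorProb_nonneg (hW : ∀ x, W x ∈ stdSimplex ℝ (𝒴 × 𝒵)) {n : ℕ}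
    (c : WiretapCode 𝒳 𝒴 n) : 0 ≤ c.errorProb W := by
  refine mul_nonneg (by positivity) (Finset.sum_nonneg fun m _ => Finset.sum_nonneg fun x _ =>
    mul_nonneg ((c.enc_mem m).1 x) (Finset.sum_nonneg fun y _ => ?_))
  split_ifs
  · exact le_rfl
  · exact (memoryless_mem (mainChannel_mem hW) x).1 y

/-- With no messages both laws vanish and a Tsallis leakage would be negative, hence `hK`. -/
lemma leakage_nonneg (hp : p ∈ stdSimplex ℝ 𝒳) (hW : ∀ x, W x ∈ stdSimplex ℝ (𝒴 × 𝒵))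
    {α : ℝ≥0∞} (hα : 1 < α) {n : ℕ} (c : WiretapCode 𝒳 𝒴 n) (hK : 0 < c.K) :
    0 ≤ c.leakage α p W := by
  have hK' : (c.K : ℝ) ≠ 0 := by positivity
  have hq : sndLaw (joint p (tapChannel W)) ∈ stdSimplex ℝ 𝒵 :=
    ⟨(isJointLaw_joint hp (tapChannel_mem hW)).sndLaw_nonneg,
      (isJointLaw_joint hp (tapChannel_mem hW)).sum_sndLaw⟩
  refine secrecyDiv_nonneg hα ⟨fun mz => ?_, ?_⟩ ⟨fun mz => ?_, ?_⟩
  · exact mul_nonneg (by positivity) (Finset.sum_nonneg fun x _ => mul_nonneg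
      ((c.enc_mem _).1 x) ((memoryless_mem (tapChannel_mem hW) x).1 _))
  · simp only [WiretapCode.leakLaw, ← Finset.mul_sum, Fintype.sum_prod_type]
    have : ∀ m, ∑ z, ∑ x, c.enc m x * memoryless (tapChannel W) x z = 1 := fun m => by
      rw [Finset.sum_comm]
      simp only [← Finset.mul_sum, (memoryless_mem (tapChannel_mem hW) _).2, mul_one,
        (c.enc_mem m).2]
    simp [this, hK']
  · exact mul_nonneg (by positivity) ((iidLaw_mem hq n).1 _)
  · simp only [WiretapCode.idealLaw, ← Finset.mul_sum, Fintype.sum_prod_type, (iidLaw_mem hq n).2]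
    simp [hK']

lemma nonempty_wiretapCode (hp : p ∈ stdSimplex ℝ 𝒳) (n : ℕ) :
    Nonempty (WiretapCode 𝒳 𝒴 n) :=
  ⟨⟨1, fun _ => iidLaw p, fun _ => iidLaw_mem hp n, fun _ => 0⟩⟩

/-- A diagonal argument: every `δ` is attained for all large `n`, so codes within `1 / (n + 1)` of
the infimum of the attainable tolerances have vanishing error and leakage. -/
lemma AchievedByIIDBinning.securelyAchievable (hp : p ∈ stdSimplex ℝ 𝒳)
    (hW : ∀ x, W x ∈ stdSimplex ℝ (𝒴 × 𝒵)) {α : ℝ≥0∞} (hα : 1 < α) {R : ℝ}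
    (h : AchievedByIIDBinning α p W R) : SecurelyAchievable α p W R := by
  obtain ⟨R₁, R₂, -, -, h⟩ := h
  let S : ∀ n : ℕ, WiretapCode 𝒳 𝒴 n → ℝ → Prop := fun n c δ =>
    (2 : ℝ) ^ ((n : ℝ) * R) ≤ c.K ∧ c.errorProb W ≤ δ ∧ c.leakage α p W ≤ (δ : EReal)
  let D : ℕ → Set ℝ := fun n => {δ | 0 < δ ∧ ∃ c, S n c δ}
  have hD : ∀ δ : ℝ, 0 < δ → ∀ᶠ n in atTop, δ ∈ D n := fun δ hδ => by
    filter_upwards [(h δ hδ).eventually_const_lt zero_lt_one] with n hn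
    obtain ⟨β, f, c, ι, -, -, hK, he, hl⟩ := exists_goodPair_of_goodProb_pos hn
    exact ⟨hδ, c, hK, he, hl⟩
  have hDbdd : ∀ n, BddBelow (D n) := fun n => ⟨0, fun δ hδ => hδ.1.le⟩
  have hex : ∀ n : ℕ, ∃ c : WiretapCode 𝒳 𝒴 n, (D n).Nonempty →
      ∃ δ < sInf (D n) + 1 / ((n : ℝ) + 1), S n c δ := fun n => by
    by_cases hne : (D n).Nonempty
    · obtain ⟨δ, ⟨-, c, hc⟩, hlt⟩ := exists_lt_of_csInf_lt hne
        (show sInf (D n) < sInf (D n) + 1 / ((n : ℝ) + 1) by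
          have : 0 < 1 / ((n : ℝ) + 1) := by positivity
          linarith)
      exact ⟨c, fun _ => ⟨δ, hlt, hc⟩⟩
    · obtain ⟨c⟩ := nonempty_wiretapCode (𝒴 := 𝒴) hp n
      exact ⟨c, fun h => absurd h hne⟩
  choose c hc using hex
  have hS : ∀ e : ℝ, 0 < e → ∀ᶠ n in atTop, ∃ δ < e, S n (c n) δ := fun e he => by
    filter_upwards [hD (e / 2) (half_pos he),
      tendsto_one_div_add_atTop_nhds_zero_nat.eventually_lt_const (half_pos he)] with n h1 h2
    obtain ⟨δ, hδ, hSδ⟩ := hc n ⟨_, h1⟩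
    have := csInf_le (hDbdd n) h1
    exact ⟨δ, by linarith, hSδ⟩
  have hK : ∀ᶠ n : ℕ in atTop, (2 : ℝ) ^ ((n : ℝ) * R) ≤ (c n).K := by
    filter_upwards [hS 1 one_pos] with n hn
    obtain ⟨δ, -, h1⟩ := hn
    exact h1.1
  refine ⟨c, hK, ?_, ?_⟩
  · refine tendsto_order.2 ⟨fun a ha => Eventually.of_forall fun n =>
      ha.trans_le (errorProb_nonneg hW _), fun a ha => ?_⟩
    filter_upwards [hS a ha] with n hn
    obtain ⟨δ, hδ, h1⟩ := hn
    exact h1.2.1.trans_lt hδ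
  · refine tendsto_order.2 ⟨fun a ha => ?_, fun a ha => ?_⟩
    · filter_upwards [hK] with n hn
      have : (0 : ℝ) < (c n).K := lt_of_lt_of_le (by positivity) hn
      exact ha.trans_le (leakage_nonneg hp hW hα _ (by exact_mod_cast this))
    · obtain ⟨e, he0, hea⟩ := EReal.lt_iff_exists_real_btwn.1 ha
      filter_upwards [hS e (by exact_mod_cast he0)] with n hn
      obtain ⟨δ, hδ, h1⟩ := hn
      exact (h1.2.2.trans (by exact_mod_cast hδ.le)).trans_lt hea

end Achievability

/-! ### Comparison with the rates from typical sequences -/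

section Comparison

variable {𝒳 𝒴 𝒵 : Type*} [Fintype 𝒳] [Fintype 𝒴] [Fintype 𝒵]

lemma mutualInfo_eq {J : 𝒳 → 𝒴 → ℝ} (hJ : IsJointLaw J) :
    mutualInfo J = entropy (fstLaw J) - condEntropy J := by
  have h1 : ∀ a, fstLaw J a * Real.logb 2 (fstLaw J a)
      = ∑ b, J a b * Real.logb 2 (fstLaw J a) := fun a => by rw [← Finset.sum_mul]; rfl
  simp only [mutualInfo, entropy, condEntropy, h1]
  rw [sub_neg_eq_add, neg_add_eq_sub, ← Finset.sum_sub_distrib]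
  refine Finset.sum_congr rfl fun a _ => ?_
  rw [← Finset.sum_sub_distrib]
  refine Finset.sum_congr rfl fun b _ => ?_
  by_cases h : J a b = 0
  · simp [h]
  · have hf : fstLaw J a ≠ 0 := fun h' => h ((Finset.sum_eq_zero_iff_of_nonneg
      fun b _ => hJ.nonneg a b).1 h' b (Finset.mem_univ b))
    rw [← mul_sub, ← Real.logb_div (hJ.condProb_pos h).ne' hf, condProb, div_div,
      mul_comm (sndLaw J b)]

lemma coe_sum_toEReal {κ : Type*} (s : Finset κ) (g : κ → ℝ) :
    ((∑ x ∈ s, g x : ℝ) : EReal) = ∑ x ∈ s, (g x : EReal) := by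
  classical
  induction s using Finset.induction_on with
  | empty => simp
  | insert a s ha ih => rw [Finset.sum_insert ha, Finset.sum_insert ha, EReal.coe_add, ih]

variable {p : 𝒳 → ℝ} {V : 𝒳 → 𝒵 → ℝ}

/-- The real value of the Rényi divergence in the absolutely continuous case. -/
def renyiDivReal (α : ℝ≥0∞) (P Q : 𝒵 → ℝ) : ℝ :=
  open Classical in
  if α = ⊤ then Real.logb 2 (⨆ a, P a / Q a)
  else 1 / (α.toReal - 1) * Real.logb 2 (∑ a, P a ^ α.toReal * Q a ^ (1 - α.toReal))

/-- If `p x ≠ 0`, the output law given `x` is absolutely continuous with respect to the marginal; if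
`p x = 0`, an infinite divergence is killed by `0 * ⊤ = 0`. -/
lemma mul_renyiDiv_eq (hp : p ∈ stdSimplex ℝ 𝒳) (hV : ∀ x, V x ∈ stdSimplex ℝ 𝒵) (α : ℝ≥0∞)
    (x : 𝒳) : ((p x : ℝ) : EReal) * renyiDiv α (V x) (sndLaw (joint p V))
      = ((p x * renyiDivReal α (V x) (sndLaw (joint p V)) : ℝ) : EReal) := by
  by_cases h : p x = 0
  · simp [h]
  have hac : ¬ NotAC (V x) (sndLaw (joint p V)) := by
    rintro ⟨z, h1, h2⟩
    exact mul_ne_zero h h1 ((isJointLaw_joint hp hV).eq_zero_of_sndLaw h2 x)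
  rw [EReal.coe_mul, renyiDiv, if_neg hac, renyiDivReal]
  split_ifs <;> rfl

lemma exists_joint_ne_zero (hV : ∀ x, V x ∈ stdSimplex ℝ 𝒵) {x : 𝒳} (hx : p x ≠ 0) :
    ∃ z, joint p V x z ≠ 0 := by
  by_contra! h
  have := (hV x).2
  rw [Finset.sum_eq_zero fun z _ => (mul_eq_zero.1 (h z)).resolve_left hx] at this
  exact zero_ne_one this

lemma condMoment_joint (hp : p ∈ stdSimplex ℝ 𝒳) (hV : ∀ x, V x ∈ stdSimplex ℝ 𝒵) {α : ℝ}
    (hα : 1 < α) : condMoment 1 (joint p V) (α - 1)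
      = ∑ x, p x * (p x ^ (α - 1) * ∑ z, V x z ^ α * sndLaw (joint p V) z ^ (1 - α)) := by
  have hJ := isJointLaw_joint hp hV
  simp only [condMoment, one_mul, Finset.mul_sum]
  refine Finset.sum_congr rfl fun x _ => Finset.sum_congr rfl fun z _ => ?_
  have hV0 := (hV x).1 z
  have hq0 := hJ.sndLaw_nonneg z
  rw [condProb, Real.div_rpow (hJ.nonneg x z) hq0]
  simp only [joint] at *
  rw [Real.mul_rpow (hp.1 x) hV0, show 1 - α = -(α - 1) by ring, Real.rpow_neg hq0,
    show V x z ^ α = V x z ^ (α - 1) * V x z by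
      rw [← Real.rpow_add_one' hV0 (by linarith), sub_add_cancel]]
  ring

/-- By Bayes' rule the Rényi entropy of finite order is `-(α-1)⁻¹ log ∑ p(x) T(x)`, with `T(x) =
(p(x) 2^D)^(α-1)` and `D` the divergence at `x`; concavity of the logarithm gives the claim. For `α
= ∞`, `p(x) 2^D` is the maximum over `z` of `P(x|z)`, at most the overall maximum. -/
lemma condRenyiEntropy_le (hp : p ∈ stdSimplex ℝ 𝒳) (hV : ∀ x, V x ∈ stdSimplex ℝ 𝒵)
    {α : ℝ≥0∞} (hα : 1 < α) : condRenyiEntropy α (joint p V)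
      ≤ entropy p - ∑ x, p x * renyiDivReal α (V x) (sndLaw (joint p V)) := by
  have hJ := isJointLaw_joint hp hV
  set q := sndLaw (joint p V) with hq
  have hent : entropy p - ∑ x, p x * renyiDivReal α (V x) q
      = -∑ x, p x * (Real.logb 2 (p x) + renyiDivReal α (V x) q) := by
    simp only [entropy, mul_add, Finset.sum_add_distrib]
    ring
  rw [hent]
  by_cases hα' : α = ⊤
  · subst hα'
    rw [condRenyiEntropy, if_pos rfl, one_div, Real.logb_inv, neg_le_neg_iff]
    set c := ⨆ ab : 𝒳 × 𝒵, condProb (joint p V) ab.1 ab.2 with hc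
    calc ∑ x, p x * (Real.logb 2 (p x) + renyiDivReal ⊤ (V x) q)
        ≤ ∑ x, p x * Real.logb 2 c := Finset.sum_le_sum fun x _ => ?_
      _ = Real.logb 2 c := by rw [← Finset.sum_mul, hp.2, one_mul]
    rcases (hp.1 x).eq_or_lt with h | h
    · simp [← h]
    refine mul_le_mul_of_nonneg_left ?_ h.le
    obtain ⟨z₀, hz₀⟩ := exists_joint_ne_zero hV h.ne'
    have hne : Nonempty 𝒵 := ⟨z₀⟩
    have hpos : 0 < ⨆ z, V x z / q z := by
      have h1 : 0 < p x * (V x z₀ / q z₀) := by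
        rw [mul_div_assoc']; exact hJ.condProb_pos hz₀
      exact (pos_of_mul_pos_right h1 h.le).trans_le
        (le_ciSup (f := fun z => V x z / q z) (Set.finite_range _).bddAbove z₀)
    rw [renyiDivReal, if_pos rfl, ← Real.logb_mul h.ne' hpos.ne']
    refine Real.logb_le_logb_of_le (by norm_num) (mul_pos h hpos) ?_
    obtain ⟨z₁, hz₁⟩ := exists_eq_ciSup_of_finite (f := fun z => V x z / q z)
    rw [← hz₁, mul_div_assoc']
    exact condProb_le_iSup (joint p V) x z₁
  · have hα1 := one_lt_toReal hα hα'
    set a := α.toReal with ha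
    set T : 𝒳 → ℝ := fun x => p x ^ (a - 1) * ∑ z, V x z ^ a * q z ^ (1 - a) with hT
    have hTpos : ∀ x, p x ≠ 0 → 0 < ∑ z, V x z ^ a * q z ^ (1 - a) := fun x hx => by
      obtain ⟨z, hz⟩ := exists_joint_ne_zero hV hx
      have hVz : 0 < V x z := ((hV x).1 z).lt_of_ne' (right_ne_zero_of_mul hz)
      have hqz : 0 < q z := ((hJ.nonneg x z).lt_of_ne' hz).trans_le (hJ.le_sndLaw x z)
      refine (show 0 < V x z ^ a * q z ^ (1 - a) by positivity).trans_le
        (Finset.single_le_sum (f := fun z => V x z ^ a * q z ^ (1 - a)) (fun z _ =>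
          mul_nonneg (Real.rpow_nonneg ((hV x).1 z) _) (Real.rpow_nonneg (hJ.sndLaw_nonneg z) _))
          (Finset.mem_univ z))
    rw [condRenyiEntropy, if_neg hα', sum_sndLaw_mul_sum_condProb_rpow hJ (by linarith),
      condMoment_joint hp hV hα1, ← ha]
    -- Jensen's inequality needs `T x > 0`, which is available only on the support of `p`.
    have hsupp : ∀ F : 𝒳 → ℝ, ∑ x, p x * F x
        = ∑ x ∈ Finset.univ.filter (fun x => p x ≠ 0), p x * F x := fun F =>
      (Finset.sum_filter_of_ne fun x _ hx => left_ne_zero_of_mul hx).symm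
    have hjensen : ∑ x, p x * Real.log (T x) ≤ Real.log (∑ x, p x * T x) := by
      rw [hsupp, hsupp]
      have h1 := strictConcaveOn_log_Ioi.concaveOn.le_map_sum
        (t := Finset.univ.filter (fun x => p x ≠ 0)) (w := p) (p := T)
        (fun x _ => hp.1 x) (by rw [Finset.sum_filter_ne_zero, hp.2]) (fun x hx => ?_)
      · simpa only [smul_eq_mul] using h1
      · have hx' := (Finset.mem_filter.1 hx).2
        exact mul_pos (Real.rpow_pos_of_pos ((hp.1 x).lt_of_ne' hx') _) (hTpos x hx')
    have hterm : ∀ x, p x * (Real.logb 2 (p x) + renyiDivReal α (V x) q)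
        = 1 / (a - 1) / Real.log 2 * (p x * Real.log (T x)) := fun x => by
      by_cases hx : p x = 0
      · simp [hx]
      have hx' := (hp.1 x).lt_of_ne' hx
      have h2 : Real.log 2 ≠ 0 := (Real.log_pos (by norm_num)).ne'
      have h3 : a - 1 ≠ 0 := by linarith
      rw [hT, renyiDivReal, if_neg hα', ← ha]
      dsimp only
      rw [Real.log_mul (Real.rpow_pos_of_pos hx' _).ne' (hTpos x hx).ne', Real.log_rpow hx',
        Real.logb, Real.logb]
      field_simp
    simp only [hterm, ← Finset.mul_sum]
    have h4 := mul_le_mul_of_nonneg_left hjensen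
      (show 0 ≤ 1 / (a - 1) / Real.log 2 from div_nonneg
        (one_div_nonneg.2 (by linarith)) (Real.log_pos (by norm_num)).le)
    have h5 : 1 / (1 - a) * Real.logb 2 (∑ x, p x * T x)
        = -(1 / (a - 1) / Real.log 2 * Real.log (∑ x, p x * T x)) := by
      rw [Real.logb, show 1 - a = -(a - 1) by ring, one_div, inv_neg]
      ring
    rw [h5]
    exact neg_le_neg h4

end Comparison

end Wiretap

end

theorem mainTheorem11 {𝒳 𝒴 𝒵 : Type*} [Fintype 𝒳] [Fintype 𝒴] [Fintype 𝒵]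
    (p : 𝒳 → ℝ) (hp : p ∈ stdSimplex ℝ 𝒳)
    (W : 𝒳 → 𝒴 × 𝒵 → ℝ) (hW : ∀ x, W x ∈ stdSimplex ℝ (𝒴 × 𝒵))
    (α : ℝ≥0∞) (hα : 1 < α) :
    (∀ R : ℝ, 0 ≤ R →
      R < Wiretap.condRenyiEntropy α (Wiretap.joint p (Wiretap.tapChannel W))
          - Wiretap.condEntropy (Wiretap.joint p (Wiretap.mainChannel W)) →
      Wiretap.AchievedByIIDBinning α p W R ∧ Wiretap.SecurelyAchievable α p W R) ∧
    ((Wiretap.condRenyiEntropy α (Wiretap.joint p (Wiretap.tapChannel W)) : ℝ) : EReal)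
      ≤ ((Wiretap.entropy p : ℝ) : EReal)
        - ∑ x, ((p x : ℝ) : EReal) * Wiretap.renyiDiv α (Wiretap.tapChannel W x)
            (Wiretap.sndLaw (Wiretap.joint p (Wiretap.tapChannel W))) ∧
    ((Wiretap.condRenyiEntropy α (Wiretap.joint p (Wiretap.tapChannel W))
        - Wiretap.condEntropy (Wiretap.joint p (Wiretap.mainChannel W)) : ℝ) : EReal)
      ≤ ((Wiretap.mutualInfo (Wiretap.joint p (Wiretap.mainChannel W)) : ℝ) : EReal)
        - ∑ x, ((p x : ℝ) : EReal) * Wiretap.renyiDiv α (Wiretap.tapChannel W x)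
            (Wiretap.sndLaw (Wiretap.joint p (Wiretap.tapChannel W))) := by
  have hT := Wiretap.tapChannel_mem hW
  have hM := Wiretap.mainChannel_mem hW
  have hle := Wiretap.condRenyiEntropy_le hp hT hα
  refine ⟨fun R hR hlt => ?_, ?_, ?_⟩
  · have h := Wiretap.achievedByIIDBinning hp hW hα hR hlt
    exact ⟨h, h.securelyAchievable hp hW hα⟩
  · simp only [Wiretap.mul_renyiDiv_eq hp hT]
    rw [← Wiretap.coe_sum_toEReal, ← EReal.coe_sub, EReal.coe_le_coe_iff]
    exact hle
  · simp only [Wiretap.mul_renyiDiv_eq hp hT]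
    rw [← Wiretap.coe_sum_toEReal, ← EReal.coe_sub, EReal.coe_le_coe_iff,
      Wiretap.mutualInfo_eq (Wiretap.isJointLaw_joint hp hM), Wiretap.fstLaw_joint p hM]
    linarith
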